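/- Let $\mathcal K$ be a (pseudo) double category, with vertical morphisms $f\colon A\to C$ (composed strictly), horizontal morphisms $J\colon A⇸B$ (composition $\odot$, units $1_A$, associative and unital up to coherent invertible cells) and square-shaped cells. A cell $\phi$ from $J$ to $K$ with vertical boundary $f, g$ is *cartesian* if every cell with vertical boundary $f\circ h$, $g\circ k$ and horizontal target $K$ factors uniquely through $\phi$; $J$ is then called the restriction $K(f,g)$. Assume that $\mathcal K$ is an *equipment*: all restrictions exist. The companion $f_*\colon A⇸C$ of $f\colon A\to C$ is the restriction $1_C(f,\mathrm{id})$; $f$ is *full and faithful* if its unit cell $1_f$ is cartesian. A vertical cell is a cell whose horizontal source and target are units; these are the 2-cells of the vertical 2-category $V(\mathcal K)$. A cell $\eta$ from $J\colon A⇸B$ to $1_M$, with vertical source $d$ and vertical target $l$, defines $l$ as the *pointwise left Kan extension* of $d$ along $J$ if, for all $H\colon B⇸C$ and $k\colon C\to M$, every cell from $J\odot H$ to $1_M$ with vertical source $d$ and vertical target $k$ equals $\eta\odot\psi$ (identifying $1_M\odot 1_M$ with $1_M$) for a unique cell $\psi$ from $H$ to $1_M$ with vertical source $l$ and vertical target $k$.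 A vertical morphism $y_A\colon A\to\hat A$ is a *yoneda embedding* if (c) for every $J\colon A⇸B$ there are $g\colon B\to\hat A$ and a cartesian cell from $J$ to $1_{\hat A}$ with vertical boundary $y_A, g$; and (e) every cartesian cell from $J$ to $1_{\hat A}$ with vertical boundary $y_A, l$ defines $l$ as the pointwise left Kan extension of $y_A$ along $J$. Let $T=(T,\mu,\iota)$ be a normal lax double monad on $\mathcal K$: a lax double functor $T\colon\mathcal K\to\mathcal K$ whose unitor cells $1_{TA}\Rightarrow T1_A$ are identities, with double transformations $\mu\colon T^2\Rightarrow T$ and $\iota\colon\mathrm{id}\Rightarrow T$ satisfying the usual monad laws. Assume that the 2-monad to which $T$ restricts on $V(\mathcal K)$ is *colax-idempotent*: for all strict algebras $(A,a)$ and $(C,c)$ of this 2-monad, every morphism $f\colon A\to C$ admits a unique 2-cell $f\circ a\Rightarrow c\circ Tf$ making it a colax morphism of algebras. **Proposition.** Let $y_A\colon A\to\hat A$ be a yoneda embedding in $\mathcal K$, let $y_{A*}\colon A⇸\hat A$ and $\iota_{\hat A*}\colon\hat A⇸T\hat A$ be companions of $y_A$ and of $\iota_{\hat A}\colon\hat A\to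 T\hat A$, and let $w\colon T\hat A\to\hat A$ be a morphism together with a cartesian cell from $y_{A*}\odot\iota_{\hat A*}$ to $1_{\hat A}$ with vertical source $y_A$ and vertical target $w$ (such $w$ exists by (c) and is unique up to isomorphism by (e)). Then $w$ can be extended to a lax $T$-algebra structure $(w,\bar w,\hat w)$ on $\hat A$, with associator $\bar w\colon w\circ Tw\Rightarrow w\circ\mu_{\hat A}$ and unitor $\hat w\colon\mathrm{id}_{\hat A}\Rightarrow w\circ\iota_{\hat A}$ satisfying the associativity axiom and the two unit axioms, such that $\bar w$ is invertible and such that $\hat w$ is invertible if and only if $\iota_{\hat A}\colon\hat A\to T\hat A$ is full and faithful. -/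

import Mathlib

open CategoryTheory

universe c h v u

/-- A (pseudo) double category: objects and vertical morphisms form a category, `Hor A B` is the
type of horizontal morphisms `A ⇸ B`, and `Cell f g J K` is the type of cells with vertical source
`f`, vertical target `g`, horizontal source `J` and horizontal target `K`.  Vertical composition is
strictly associative and unital; horizontal composition is so up to coherent invertible cells.
`f ≫ g` and the composites `vcomp`, `hcomp` are written in diagrammatic order.  Equalities of cells
whose vertical boundaries agree only propositionally are stated with `HEq`. -/
class DoubleCategory (𝕂 : Type u) extends Category.{v} 𝕂 where
  Hor : 𝕂 → 𝕂 → Type h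
  Cell : {A B C D : 𝕂} → (A ⟶ C) → (B ⟶ D) → Hor A B → Hor C D → Type c
  /-- the vertical identity cell of a horizontal morphism -/
  vid : {A B : 𝕂} → (J : Hor A B) → Cell (𝟙 A) (𝟙 B) J J
  /-- vertical composition of cells, the first one on top -/
  vcomp : {A B C D E F : 𝕂} → {f : A ⟶ C} → {g : B ⟶ D} → {f' : C ⟶ E} → {g' : D ⟶ F} →
    {J : Hor A B} → {K : Hor C D} → {L : Hor E F} →
    Cell f g J K → Cell f' g' K L → Cell (f ≫ f') (g ≫ g') J L
  /-- the horizontal unit `1_A` -/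
  unit : (A : 𝕂) → Hor A A
  /-- the horizontal unit cell `1_f` of a vertical morphism -/
  unitCell : {A C : 𝕂} → (f : A ⟶ C) → Cell f f (unit A) (unit C)
  /-- horizontal composition of horizontal morphisms -/
  hor : {A B C : 𝕂} → Hor A B → Hor B C → Hor A C
  /-- horizontal composition of cells -/
  hcomp : {A B C A' B' C' : 𝕂} → {f : A ⟶ A'} → {g : B ⟶ B'} → {k : C ⟶ C'} →
    {J : Hor A B} → {H : Hor B C} → {J' : Hor A' B'} → {H' : Hor B' C'} →
    Cell f g J J' → Cell g k H H' → Cell f k (hor J H) (hor J' H')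
  associator : {A B C D : 𝕂} → (J : Hor A B) → (H : Hor B C) → (L : Hor C D) →
    Cell (𝟙 A) (𝟙 D) (hor (hor J H) L) (hor J (hor H L))
  associatorInv : {A B C D : 𝕂} → (J : Hor A B) → (H : Hor B C) → (L : Hor C D) →
    Cell (𝟙 A) (𝟙 D) (hor J (hor H L)) (hor (hor J H) L)
  leftUnitor : {A B : 𝕂} → (J : Hor A B) → Cell (𝟙 A) (𝟙 B) (hor (unit A) J) J
  leftUnitorInv : {A B : 𝕂} → (J : Hor A B) → Cell (𝟙 A) (𝟙 B) J (hor (unit A) J)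
  rightUnitor : {A B : 𝕂} → (J : Hor A B) → Cell (𝟙 A) (𝟙 B) (hor J (unit B)) J
  rightUnitorInv : {A B : 𝕂} → (J : Hor A B) → Cell (𝟙 A) (𝟙 B) J (hor J (unit B))
  vid_vcomp : ∀ {A B C D : 𝕂} {f : A ⟶ C} {g : B ⟶ D} {J : Hor A B} {K : Hor C D}
    (φ : Cell f g J K), HEq (vcomp (vid J) φ) φ
  vcomp_vid : ∀ {A B C D : 𝕂} {f : A ⟶ C} {g : B ⟶ D} {J : Hor A B} {K : Hor C D}
    (φ : Cell f g J K), HEq (vcomp φ (vid K)) φ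
  vcomp_assoc : ∀ {A₀ B₀ A₁ B₁ A₂ B₂ A₃ B₃ : 𝕂} {f₁ : A₀ ⟶ A₁} {g₁ : B₀ ⟶ B₁} {f₂ : A₁ ⟶ A₂}
    {g₂ : B₁ ⟶ B₂} {f₃ : A₂ ⟶ A₃} {g₃ : B₂ ⟶ B₃} {J₀ : Hor A₀ B₀} {J₁ : Hor A₁ B₁}
    {J₂ : Hor A₂ B₂} {J₃ : Hor A₃ B₃}
    (φ : Cell f₁ g₁ J₀ J₁) (ψ : Cell f₂ g₂ J₁ J₂) (χ : Cell f₃ g₃ J₂ J₃),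
    HEq (vcomp (vcomp φ ψ) χ) (vcomp φ (vcomp ψ χ))
  unitCell_id : ∀ A : 𝕂, unitCell (𝟙 A) = vid (unit A)
  unitCell_comp : ∀ {A C E : 𝕂} (f : A ⟶ C) (g : C ⟶ E),
    unitCell (f ≫ g) = vcomp (unitCell f) (unitCell g)
  hcomp_vid : ∀ {A B C : 𝕂} (J : Hor A B) (H : Hor B C), hcomp (vid J) (vid H) = vid (hor J H)
  interchange : ∀ {A₀ B₀ C₀ A₁ B₁ C₁ A₂ B₂ C₂ : 𝕂} {f₁ : A₀ ⟶ A₁} {g₁ : B₀ ⟶ B₁} {k₁ : C₀ ⟶ C₁}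
    {f₂ : A₁ ⟶ A₂} {g₂ : B₁ ⟶ B₂} {k₂ : C₁ ⟶ C₂} {J₀ : Hor A₀ B₀} {H₀ : Hor B₀ C₀}
    {J₁ : Hor A₁ B₁} {H₁ : Hor B₁ C₁} {J₂ : Hor A₂ B₂} {H₂ : Hor B₂ C₂}
    (φ₁ : Cell f₁ g₁ J₀ J₁) (ψ₁ : Cell g₁ k₁ H₀ H₁) (φ₂ : Cell f₂ g₂ J₁ J₂)
    (ψ₂ : Cell g₂ k₂ H₁ H₂),
    hcomp (vcomp φ₁ φ₂) (vcomp ψ₁ ψ₂) = vcomp (hcomp φ₁ ψ₁) (hcomp φ₂ ψ₂)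
  associator_hom_inv : ∀ {A B C D : 𝕂} (J : Hor A B) (H : Hor B C) (L : Hor C D),
    HEq (vcomp (associator J H L) (associatorInv J H L)) (vid (hor (hor J H) L))
  associator_inv_hom : ∀ {A B C D : 𝕂} (J : Hor A B) (H : Hor B C) (L : Hor C D),
    HEq (vcomp (associatorInv J H L) (associator J H L)) (vid (hor J (hor H L)))
  leftUnitor_hom_inv : ∀ {A B : 𝕂} (J : Hor A B),
    HEq (vcomp (leftUnitor J) (leftUnitorInv J)) (vid (hor (unit A) J))
  leftUnitor_inv_hom : ∀ {A B : 𝕂} (J : Hor A B),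
    HEq (vcomp (leftUnitorInv J) (leftUnitor J)) (vid J)
  rightUnitor_hom_inv : ∀ {A B : 𝕂} (J : Hor A B),
    HEq (vcomp (rightUnitor J) (rightUnitorInv J)) (vid (hor J (unit B)))
  rightUnitor_inv_hom : ∀ {A B : 𝕂} (J : Hor A B),
    HEq (vcomp (rightUnitorInv J) (rightUnitor J)) (vid J)
  associator_naturality : ∀ {A B C D A' B' C' D' : 𝕂} {f : A ⟶ A'} {g : B ⟶ B'} {k : C ⟶ C'}
    {l : D ⟶ D'} {J : Hor A B} {H : Hor B C} {L : Hor C D} {J' : Hor A' B'} {H' : Hor B' C'}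
    {L' : Hor C' D'} (φ : Cell f g J J') (ψ : Cell g k H H') (χ : Cell k l L L'),
    HEq (vcomp (hcomp (hcomp φ ψ) χ) (associator J' H' L'))
      (vcomp (associator J H L) (hcomp φ (hcomp ψ χ)))
  leftUnitor_naturality : ∀ {A B C D : 𝕂} {f : A ⟶ C} {g : B ⟶ D} {J : Hor A B} {K : Hor C D}
    (φ : Cell f g J K),
    HEq (vcomp (hcomp (unitCell f) φ) (leftUnitor K)) (vcomp (leftUnitor J) φ)
  rightUnitor_naturality : ∀ {A B C D : 𝕂} {f : A ⟶ C} {g : B ⟶ D} {J : Hor A B} {K : Hor C D}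
    (φ : Cell f g J K),
    HEq (vcomp (hcomp φ (unitCell g)) (rightUnitor K)) (vcomp (rightUnitor J) φ)
  pentagon : ∀ {A B C D E : 𝕂} (J : Hor A B) (H : Hor B C) (L : Hor C D) (P : Hor D E),
    HEq (vcomp (vcomp (hcomp (associator J H L) (vid P)) (associator J (hor H L) P))
        (hcomp (vid J) (associator H L P)))
      (vcomp (associator (hor J H) L P) (associator J H (hor L P)))
  triangle : ∀ {A B C : 𝕂} (J : Hor A B) (H : Hor B C),
    HEq (vcomp (associator J (unit B) H) (hcomp (vid J) (leftUnitor H)))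
      (hcomp (rightUnitor J) (vid H))

namespace DoubleCategory

section Cells

variable {𝕂 : Type u} [DoubleCategory.{c, h, v} 𝕂]

/-- A cell, regarded as a cell with an equal boundary. -/
def recast {A B C D : 𝕂} {f f' : A ⟶ C} {g g' : B ⟶ D} {J J' : Hor A B} {K K' : Hor C D}
    (hf : f = f') (hg : g = g') (hJ : J = J') (hK : K = K') (φ : Cell f g J K) :
    Cell f' g' J' K' :=
  cast (by rw [hf, hg, hJ, hK]) φ

/-- `φ` is cartesian: every cell with the boundary `(h ≫ f, k ≫ g, H, K)` factors uniquely
through `φ`. -/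
def IsCartesian {A B C D : 𝕂} {f : A ⟶ C} {g : B ⟶ D} {J : Hor A B} {K : Hor C D}
    (φ : Cell f g J K) : Prop :=
  ∀ ⦃X Y : 𝕂⦄ (h : X ⟶ A) (k : Y ⟶ B) (H : Hor X Y) (χ : Cell (h ≫ f) (k ≫ g) H K),
    ∃! ψ : Cell h k H J, vcomp ψ φ = χ

/-- `φ` is a cartesian cell defining `J` as the companion `f_*` of `f`, that is, as the
restriction `1_C(f, id)`. -/
def IsCompanion {A C : 𝕂} (f : A ⟶ C) (J : Hor A C) (φ : Cell f (𝟙 C) J (unit C)) : Prop :=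
  IsCartesian φ

/-- `f` is full and faithful: its unit cell is cartesian. -/
def FullFaithful {A C : 𝕂} (f : A ⟶ C) : Prop :=
  IsCartesian (unitCell f)

variable (𝕂) in
/-- An equipment: a double category in which all restrictions `K(f, g)` exist. -/
def IsEquipment : Prop :=
  ∀ ⦃A B C D : 𝕂⦄ (f : A ⟶ C) (K : Hor C D) (g : B ⟶ D),
    ∃ (J : Hor A B) (φ : Cell f g J K), IsCartesian φ

/-- `η` defines `l` as the pointwise left Kan extension of `d` along `J`: every cell `φ` from
`J ⊙ H` to `1_M`, with vertical source `d`, is uniquely of the form `η ⊙ ψ` (where `1_M ⊙ 1_M` is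
identified with `1_M`). -/
def IsPointwiseLeftKan {A B M : 𝕂} {d : A ⟶ M} {l : B ⟶ M} {J : Hor A B}
    (η : Cell d l J (unit M)) : Prop :=
  ∀ ⦃C : 𝕂⦄ (H : Hor B C) (k : C ⟶ M) (φ : Cell d k (hor J H) (unit M)),
    ∃! ψ : Cell l k H (unit M), HEq (vcomp (hcomp η ψ) (leftUnitor (unit M))) φ

/-- Yoneda embeddings `y : A ⟶ P`, where `P` plays the role of the presheaf object of `A`. -/
structure IsYonedaEmbedding {A P : 𝕂} (y : A ⟶ P) : Prop where
  /-- axiom (c) -/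
  exists_cartesian : ∀ ⦃B : 𝕂⦄ (J : Hor A B),
    ∃ (g : B ⟶ P) (φ : Cell y g J (unit P)), IsCartesian φ
  /-- axiom (e) -/
  isPointwiseLeftKan : ∀ ⦃B : 𝕂⦄ (J : Hor A B) (l : B ⟶ P) (η : Cell y l J (unit P)),
    IsCartesian η → IsPointwiseLeftKan η

/-- Vertical cells `f ⇒ g`: the 2-cells of the vertical 2-category `V(𝕂)`.  The identity of `f`
is `unitCell f`. -/
abbrev VCell {A C : 𝕂} (f g : A ⟶ C) : Type c := Cell f g (unit A) (unit C)

/-- The composite `f ⇒ g ⇒ k` in `V(𝕂)`: the horizontal composite of cells, with the horizontal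
units `1 ⊙ 1` identified with `1`. -/
def VCell.comp {A C : 𝕂} {f g k : A ⟶ C} (φ : VCell f g) (ψ : VCell g k) : VCell f k :=
  recast (by rw [Category.comp_id, Category.id_comp]) (by rw [Category.comp_id, Category.id_comp])
    rfl rfl (vcomp (vcomp (leftUnitorInv (unit A)) (hcomp φ ψ)) (leftUnitor (unit C)))

infixr:80 " ≫ᵥ " => VCell.comp

/-- Whiskering in `V(𝕂)`: a 2-cell `g ⇒ k` gives `f ≫ g ⇒ f ≫ k`. -/
def VCell.whiskerLeft {A B C : 𝕂} (f : A ⟶ B) {g k : B ⟶ C} (φ : VCell g k) :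
    VCell (f ≫ g) (f ≫ k) :=
  vcomp (unitCell f) φ

/-- Whiskering in `V(𝕂)`: a 2-cell `f ⇒ g` gives `f ≫ k ⇒ g ≫ k`. -/
def VCell.whiskerRight {A B C : 𝕂} {f g : A ⟶ B} (φ : VCell f g) (k : B ⟶ C) :
    VCell (f ≫ k) (g ≫ k) :=
  vcomp φ (unitCell k)

/-- The identity 2-cell between equal vertical morphisms. -/
def VCell.ofEq {A C : 𝕂} {f g : A ⟶ C} (e : f = g) : VCell f g :=
  recast rfl e rfl rfl (unitCell f)

/-- Invertibility in `V(𝕂)`. -/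
def VCell.IsInvertible {A C : 𝕂} {f g : A ⟶ C} (φ : VCell f g) : Prop :=
  ∃ ψ : VCell g f, φ ≫ᵥ ψ = unitCell f ∧ ψ ≫ᵥ φ = unitCell g

end Cells

end DoubleCategory

open DoubleCategory

/-- A lax double functor: strictly functorial in the vertical direction, with coherent compositor
cells `F J ⊙ F H ⇒ F (J ⊙ H)` and unitor cells `1_{F A} ⇒ F 1_A`. -/
structure LaxDoubleFunctor (𝕂 : Type u) [DoubleCategory.{c, h, v} 𝕂]
    (𝕃 : Type u) [DoubleCategory.{c, h, v} 𝕃] extends 𝕂 ⥤ 𝕃 where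
  mapHor : {A B : 𝕂} → Hor A B → Hor (obj A) (obj B)
  mapCell : {A B C D : 𝕂} → {f : A ⟶ C} → {g : B ⟶ D} → {J : Hor A B} → {K : Hor C D} →
    Cell f g J K → Cell (map f) (map g) (mapHor J) (mapHor K)
  compositor : {A B C : 𝕂} → (J : Hor A B) → (H : Hor B C) →
    Cell (𝟙 (obj A)) (𝟙 (obj C)) (hor (mapHor J) (mapHor H)) (mapHor (hor J H))
  unitor : (A : 𝕂) → Cell (𝟙 (obj A)) (𝟙 (obj A)) (unit (obj A)) (mapHor (unit A))
  mapCell_vid : ∀ {A B : 𝕂} (J : Hor A B), HEq (mapCell (vid J)) (vid (mapHor J))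
  mapCell_vcomp : ∀ {A B C D E F : 𝕂} {f : A ⟶ C} {g : B ⟶ D} {f' : C ⟶ E} {g' : D ⟶ F}
    {J : Hor A B} {K : Hor C D} {L : Hor E F} (φ : Cell f g J K) (ψ : Cell f' g' K L),
    HEq (mapCell (vcomp φ ψ)) (vcomp (mapCell φ) (mapCell ψ))
  compositor_naturality : ∀ {A B C A' B' C' : 𝕂} {f : A ⟶ A'} {g : B ⟶ B'} {k : C ⟶ C'}
    {J : Hor A B} {H : Hor B C} {J' : Hor A' B'} {H' : Hor B' C'}
    (φ : Cell f g J J') (ψ : Cell g k H H'),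
    HEq (vcomp (hcomp (mapCell φ) (mapCell ψ)) (compositor J' H'))
      (vcomp (compositor J H) (mapCell (hcomp φ ψ)))
  unitor_naturality : ∀ {A C : 𝕂} (f : A ⟶ C),
    HEq (vcomp (unitCell (map f)) (unitor C)) (vcomp (unitor A) (mapCell (unitCell f)))
  compositor_assoc : ∀ {A B C D : 𝕂} (J : Hor A B) (H : Hor B C) (L : Hor C D),
    HEq (vcomp (vcomp (hcomp (compositor J H) (vid (mapHor L))) (compositor (hor J H) L))
        (mapCell (associator J H L)))
      (vcomp (vcomp (associator (mapHor J) (mapHor H) (mapHor L))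
        (hcomp (vid (mapHor J)) (compositor H L))) (compositor J (hor H L)))
  compositor_leftUnitor : ∀ {A B : 𝕂} (J : Hor A B),
    HEq (vcomp (vcomp (hcomp (unitor A) (vid (mapHor J))) (compositor (unit A) J))
        (mapCell (leftUnitor J)))
      (leftUnitor (mapHor J))
  compositor_rightUnitor : ∀ {A B : 𝕂} (J : Hor A B),
    HEq (vcomp (vcomp (hcomp (vid (mapHor J)) (unitor B)) (compositor J (unit B)))
        (mapCell (rightUnitor J)))
      (rightUnitor (mapHor J))

/-- A lax double functor is normal if its unitor cells are identities. -/
structure LaxDoubleFunctor.IsNormal {𝕂 : Type u} [DoubleCategory.{c, h, v} 𝕂]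
    {𝕃 : Type u} [DoubleCategory.{c, h, v} 𝕃] (F : LaxDoubleFunctor 𝕂 𝕃) : Prop where
  mapHor_unit : ∀ A : 𝕂, F.mapHor (unit A) = unit (F.obj A)
  unitor_eq : ∀ A : 𝕂, HEq (F.unitor A) (vid (unit (F.obj A)))

/-- A normal lax double monad `T = (T, μ, ι)` on `𝕂`: a normal lax double functor `T : 𝕂 → 𝕂` with
double transformations `μ : T² ⇒ T` and `ι : id ⇒ T` satisfying the associativity and unit laws. -/
structure NormalLaxDoubleMonad (𝕂 : Type u) [DoubleCategory.{c, h, v} 𝕂]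
    extends LaxDoubleFunctor 𝕂 𝕂 where
  isNormal : toLaxDoubleFunctor.IsNormal
  mu : (A : 𝕂) → (obj (obj A) ⟶ obj A)
  muCell : {A B : 𝕂} → (J : Hor A B) → Cell (mu A) (mu B) (mapHor (mapHor J)) (mapHor J)
  iota : (A : 𝕂) → (A ⟶ obj A)
  iotaCell : {A B : 𝕂} → (J : Hor A B) → Cell (iota A) (iota B) J (mapHor J)
  mu_naturality : ∀ {A C : 𝕂} (f : A ⟶ C), map (map f) ≫ mu C = mu A ≫ map f
  muCell_naturality : ∀ {A B C D : 𝕂} {f : A ⟶ C} {g : B ⟶ D} {J : Hor A B} {K : Hor C D}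
    (φ : Cell f g J K),
    HEq (vcomp (mapCell (mapCell φ)) (muCell K)) (vcomp (muCell J) (mapCell φ))
  iota_naturality : ∀ {A C : 𝕂} (f : A ⟶ C), f ≫ iota C = iota A ≫ map f
  iotaCell_naturality : ∀ {A B C D : 𝕂} {f : A ⟶ C} {g : B ⟶ D} {J : Hor A B} {K : Hor C D}
    (φ : Cell f g J K), HEq (vcomp φ (iotaCell K)) (vcomp (iotaCell J) (mapCell φ))
  /-- composition axiom for `μ`; the compositor of `T²` is `T(T_⊙) ∘ T_⊙` -/
  muCell_hor : ∀ {A B C : 𝕂} (J : Hor A B) (H : Hor B C),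
    HEq (vcomp (hcomp (muCell J) (muCell H)) (compositor J H))
      (vcomp (vcomp (compositor (mapHor J) (mapHor H)) (mapCell (compositor J H)))
        (muCell (hor J H)))
  /-- unit axiom for `μ`; the unitor of `T²` is `T(T_1) ∘ T_1` -/
  muCell_unit : ∀ A : 𝕂,
    HEq (vcomp (unitCell (mu A)) (unitor A))
      (vcomp (vcomp (unitor (obj A)) (mapCell (unitor A))) (muCell (unit A)))
  /-- composition axiom for `ι` -/
  iotaCell_hor : ∀ {A B C : 𝕂} (J : Hor A B) (H : Hor B C),
    HEq (vcomp (hcomp (iotaCell J) (iotaCell H)) (compositor J H)) (iotaCell (hor J H))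
  /-- unit axiom for `ι` -/
  iotaCell_unit : ∀ A : 𝕂,
    HEq (vcomp (unitCell (iota A)) (unitor A)) (iotaCell (unit A))
  mu_assoc : ∀ A : 𝕂, mu (obj A) ≫ mu A = map (mu A) ≫ mu A
  muCell_assoc : ∀ {A B : 𝕂} (J : Hor A B),
    HEq (vcomp (muCell (mapHor J)) (muCell J)) (vcomp (mapCell (muCell J)) (muCell J))
  iota_mu : ∀ A : 𝕂, iota (obj A) ≫ mu A = 𝟙 (obj A)
  iotaCell_muCell : ∀ {A B : 𝕂} (J : Hor A B),
    HEq (vcomp (iotaCell (mapHor J)) (muCell J)) (vid (mapHor J))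
  map_iota_mu : ∀ A : 𝕂, map (iota A) ≫ mu A = 𝟙 (obj A)
  mapCell_iotaCell_muCell : ∀ {A B : 𝕂} (J : Hor A B),
    HEq (vcomp (mapCell (iotaCell J)) (muCell J)) (vid (mapHor J))

namespace NormalLaxDoubleMonad

variable {𝕂 : Type u} [DoubleCategory.{c, h, v} 𝕂] (T : NormalLaxDoubleMonad 𝕂)

/-- The action of `T` on the 2-cells of `V(𝕂)`; note that `T 1_A = 1_{T A}`. -/
def mapV {A C : 𝕂} {f g : A ⟶ C} (φ : VCell f g) : VCell (T.map f) (T.map g) :=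
  recast rfl rfl (T.isNormal.mapHor_unit A) (T.isNormal.mapHor_unit C) (T.mapCell φ)

/-- Strict algebras for the 2-monad that `T` restricts to on `V(𝕂)`. -/
structure StrictAlgebra (A : 𝕂) where
  act : T.obj A ⟶ A
  assoc : T.map act ≫ act = T.mu A ≫ act
  unit : T.iota A ≫ act = 𝟙 A

variable {T} in
/-- `fbar : f ∘ a ⇒ c ∘ T f` makes `f` into a colax morphism from `(A, a)` to `(C, c)`. -/
structure IsColaxMorphism {A C : 𝕂} (a : T.StrictAlgebra A) (c : T.StrictAlgebra C) (f : A ⟶ C)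
    (fbar : VCell (a.act ≫ f) (T.map f ≫ c.act)) : Prop where
  unit : HEq (VCell.whiskerLeft (T.iota A) fbar) (unitCell f)
  assoc : HEq (VCell.whiskerLeft (T.mu A) fbar)
    (VCell.whiskerLeft (T.map a.act) fbar ≫ᵥ
      VCell.ofEq (show T.map a.act ≫ T.map f ≫ c.act = T.map (a.act ≫ f) ≫ c.act by
        rw [T.map_comp, Category.assoc]) ≫ᵥ
      VCell.whiskerRight (T.mapV fbar) c.act)

/-- The 2-monad that `T` restricts to on `V(𝕂)` is colax-idempotent: every morphism between the
underlying objects of (strict) `T`-algebras carries a unique structure of colax morphism. -/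
def IsColaxIdempotent : Prop :=
  ∀ ⦃A C : 𝕂⦄ (a : T.StrictAlgebra A) (c : T.StrictAlgebra C) (f : A ⟶ C),
    ∃! fbar : VCell (a.act ≫ f) (T.map f ≫ c.act), IsColaxMorphism a c f fbar

/-- Lax `T`-algebra structures `(w, wbar, what)` with action `w`, for the 2-monad that `T` restricts
to on `V(𝕂)`: an associator `w ∘ T w ⇒ w ∘ μ` and a unitor `id ⇒ w ∘ ι`, subject to two unit axioms
and the associativity axiom. -/
structure LaxAlgebraStructure {M : 𝕂} (w : T.obj M ⟶ M) where
  associator : VCell (T.map w ≫ w) (T.mu M ≫ w)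
  unitor : VCell (𝟙 M) (T.iota M ≫ w)
  /-- `w = w ∘ T id ⇒ w ∘ T w ∘ T ι ⇒ w ∘ μ ∘ T ι = w` is the identity -/
  map_unitor_associator :
    HEq (VCell.whiskerRight (T.mapV unitor) w ≫ᵥ
        VCell.ofEq (show T.map (T.iota M ≫ w) ≫ w = T.map (T.iota M) ≫ T.map w ≫ w by
          rw [T.map_comp, Category.assoc]) ≫ᵥ
        VCell.whiskerLeft (T.map (T.iota M)) associator)
      (unitCell w)
  /-- `w = id ∘ w ⇒ w ∘ ι ∘ w = w ∘ T w ∘ ι ⇒ w ∘ μ ∘ ι = w` is the identity -/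
  unitor_associator :
    HEq (VCell.whiskerLeft w unitor ≫ᵥ
        VCell.ofEq (show w ≫ T.iota M ≫ w = T.iota (T.obj M) ≫ T.map w ≫ w by
          rw [← Category.assoc, T.iota_naturality, Category.assoc]) ≫ᵥ
        VCell.whiskerLeft (T.iota (T.obj M)) associator)
      (unitCell w)
  /-- the composites `w ∘ T w ∘ T² w ⇒ w ∘ T w ∘ T μ ⇒ w ∘ μ ∘ T μ` and
  `w ∘ T w ∘ T² w ⇒ w ∘ μ ∘ T² w = w ∘ T w ∘ μ ⇒ w ∘ μ ∘ μ` agree -/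
  associator_associator :
    HEq (VCell.whiskerRight (T.mapV associator) w ≫ᵥ
        VCell.ofEq (show T.map (T.mu M ≫ w) ≫ w = T.map (T.mu M) ≫ T.map w ≫ w by
          rw [T.map_comp, Category.assoc]) ≫ᵥ
        VCell.whiskerLeft (T.map (T.mu M)) associator)
      (VCell.whiskerLeft (T.map (T.map w)) associator ≫ᵥ
        VCell.ofEq (show T.map (T.map w) ≫ T.mu M ≫ w = T.mu (T.obj M) ≫ T.map w ≫ w by
          rw [← Category.assoc, T.mu_naturality, Category.assoc]) ≫ᵥ
        VCell.whiskerLeft (T.mu (T.obj M)) associator)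

end NormalLaxDoubleMonad

/-! Write $P$ for $\hat A$ and $J = y_*\odot\iota_*$. The calculus of companions makes $J$ the
companion of $\iota y$ (`isCartesian_companion_hor`), and by assumption $J$ is also the restriction
of $1_P$ along $y$ and $w$. Factoring through the two cartesian cells $\sigma$ and $\tau$ out of $J$
gives, over every horizontal morphism, a bijection between cells $yl \Rightarrow wk$ and cells
$\iota yl \Rightarrow k$: $w$ is right adjoint to $\iota$ relative to $y$. This is `AdjRel`. A
normal lax $T$ preserves cartesian cells (`isCartesian_mapCell`), so the images of $\sigma$ and
$\tau$ under $T$ give such a correspondence one level up, and $\mu$ and $\iota$ carry corresponding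
cells to corresponding cells.

Because cartesian cells out of $y$ are pointwise left Kan extensions, a vertical cell $l \Rightarrow
l'$ into $P$ is determined by how it acts on cells $y \Rightarrow l$, and can be defined on the
cartesian one. The unitor is the cell sending $e \colon y \Rightarrow \mathrm{id}$ to the transpose
of $\iota e$. The associator transposes $e \colon y \Rightarrow w\,Tw\,k$ twice, to $x_1 \colon
\iota y \Rightarrow Tw\,k$ and then, as $\iota y = Ty\,\iota_A$, to $x_2 \colon T(\iota y)\,\iota_A
\Rightarrow k$; it sends $e$ to the transpose of $\mu x_2$. In each axiom both sides have the same
transpose, by the monad laws, hence agree.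

Colax-idempotence makes $\iota_{TP}$ left adjoint to $\mu_P$ with identity unit (`exists_counit`).
The source of $x_2$ is also $\iota_{TP}\,\iota\,y$, so $x_2 \mapsto \mu x_2$ is bijective, and a
Yoneda argument (`IsYonedaEmbedding.isInvertible`) inverts the associator. The same argument inverts
the unitor when $e \mapsto \iota e$ is bijective, that is, when $\iota$ is full and faithful.
Conversely, an inverse $v$ of the unitor yields a cell $\varepsilon \colon \iota w \Rightarrow
\mathrm{id}$ with $\varepsilon\iota = \iota v$, from which cells $\iota l \Rightarrow \iota k$ are
lifted along $\iota$. -/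

namespace DoubleCategory

/-! ### The category of cells, in which heterogeneous equalities become equalities of morphisms -/

/-- Horizontal morphisms, regarded as the objects of the category of cells. -/
structure HorObj (𝕂 : Type u) [DoubleCategory.{c, h, v} 𝕂] where
  {src tgt : 𝕂}
  hor : Hor src tgt

section

variable {𝕂 : Type u} [DoubleCategory.{c, h, v} 𝕂]

/-- Cells with unspecified vertical boundary. -/
@[ext] structure HorHom (J K : HorObj 𝕂) where
  left : J.src ⟶ K.src
  right : J.tgt ⟶ K.tgt
  cell : Cell left right J.hor K.hor

theorem cell_heq_rfl {A B C D : 𝕂} {f f' : A ⟶ C} {g g' : B ⟶ D} {J : Hor A B} {K : Hor C D}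
    {φ : Cell f g J K} {φ' : Cell f' g' J K} (hf : f = f') (hg : g = g') (hφ : HEq φ φ') :
    (⟨f, g, φ⟩ : HorHom ⟨J⟩ ⟨K⟩) = ⟨f', g', φ'⟩ := by
  subst hf hg
  rw [eq_of_heq hφ]

/-- The category of horizontal morphisms and cells. -/
instance : Category (HorObj 𝕂) where
  Hom J K := HorHom J K
  id J := ⟨𝟙 _, 𝟙 _, vid J.hor⟩
  comp φ ψ := ⟨φ.left ≫ ψ.left, φ.right ≫ ψ.right, vcomp φ.cell ψ.cell⟩
  id_comp φ := cell_heq_rfl (Category.id_comp _) (Category.id_comp _) (vid_vcomp φ.cell)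
  comp_id φ := cell_heq_rfl (Category.comp_id _) (Category.comp_id _) (vcomp_vid φ.cell)
  assoc φ ψ χ := cell_heq_rfl (Category.assoc _ _ _) (Category.assoc _ _ _)
    (vcomp_assoc φ.cell ψ.cell χ.cell)

/-- A cell as a morphism of the category of cells. -/
def tot {A B C D : 𝕂} {f : A ⟶ C} {g : B ⟶ D} {J : Hor A B} {K : Hor C D}
    (φ : Cell f g J K) : (⟨J⟩ : HorObj 𝕂) ⟶ ⟨K⟩ :=
  (⟨f, g, φ⟩ : HorHom ⟨J⟩ ⟨K⟩)

section Tot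

variable {A B C D E F X Y Z : 𝕂} {f f' : A ⟶ C} {g g' : B ⟶ D} {J J' : Hor A B} {K K' : Hor C D}

theorem tot_injective {φ ψ : Cell f g J K} (e : tot φ = tot ψ) : φ = ψ := by
  have := (HorHom.mk.injEq _ _ _ _ _ _).mp e
  exact eq_of_heq this.2.2

theorem tot_inj {φ ψ : Cell f g J K} : tot φ = tot ψ ↔ φ = ψ :=
  ⟨tot_injective, fun e => by rw [e]⟩

theorem tot_left {φ : Cell f g J K} {φ' : Cell f' g' J K} (e : tot φ = tot φ') : f = f' :=
  ((HorHom.mk.injEq _ _ _ _ _ _).mp e).1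

theorem tot_right {φ : Cell f g J K} {φ' : Cell f' g' J K} (e : tot φ = tot φ') : g = g' :=
  ((HorHom.mk.injEq _ _ _ _ _ _).mp e).2.1

theorem heq_of_tot {φ : Cell f g J K} {φ' : Cell f' g' J K} (e : tot φ = tot φ') : HEq φ φ' :=
  ((HorHom.mk.injEq _ _ _ _ _ _).mp e).2.2

theorem tot_of_heq {φ : Cell f g J K} {φ' : Cell f' g' J K} (e : HEq φ φ') (hf : f = f')
    (hg : g = g') : tot φ = tot φ' :=
  cell_heq_rfl hf hg e

@[simp] theorem tot_vcomp {f : A ⟶ C} {g : B ⟶ D} {f' : C ⟶ E} {g' : D ⟶ F}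
    {J : Hor A B} {K : Hor C D} {L : Hor E F} (φ : Cell f g J K) (ψ : Cell f' g' K L) :
    tot (vcomp φ ψ) = tot φ ≫ tot ψ := rfl

@[simp] theorem tot_vid (J : Hor A B) : tot (vid J) = 𝟙 (⟨J⟩ : HorObj 𝕂) := rfl

theorem tot_recast (hf : f = f') (hg : g = g') (φ : Cell f g J K) :
    tot (recast hf hg rfl rfl φ) = tot φ := by
  subst hf hg; rfl

/-- Vertical composition of cells, with prescribed boundary. -/
def vc {f : A ⟶ C} {g : B ⟶ D} {f' : C ⟶ E} {g' : D ⟶ F} {f'' : A ⟶ E} {g'' : B ⟶ F}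
    {J : Hor A B} {K : Hor C D} {L : Hor E F} (φ : Cell f g J K) (ψ : Cell f' g' K L)
    (hf : f ≫ f' = f'') (hg : g ≫ g' = g'') : Cell f'' g'' J L :=
  recast hf hg rfl rfl (vcomp φ ψ)

@[simp] theorem tot_vc {f : A ⟶ C} {g : B ⟶ D} {f' : C ⟶ E} {g' : D ⟶ F} {f'' : A ⟶ E}
    {g'' : B ⟶ F} {J : Hor A B} {K : Hor C D} {L : Hor E F} (φ : Cell f g J K)
    (ψ : Cell f' g' K L) (hf : f ≫ f' = f'') (hg : g ≫ g' = g'') :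
    tot (vc φ ψ hf hg) = tot φ ≫ tot ψ := tot_recast _ _ _

/-- A cell with an equal vertical boundary. -/
def cst (φ : Cell f g J K) (hf : f = f') (hg : g = g') : Cell f' g' J K :=
  recast hf hg rfl rfl φ

@[simp] theorem tot_cst (φ : Cell f g J K) (hf : f = f') (hg : g = g') :
    tot (cst φ hf hg) = tot φ := tot_recast _ _ _

theorem tot_hcomp_congr {A' B' C' : 𝕂} {f f₁ : A ⟶ A'} {g g₁ : B ⟶ B'} {k k₁ : C ⟶ C'}
    {J : Hor A B} {H : Hor B C} {J' : Hor A' B'} {H' : Hor B' C'}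
    {φ : Cell f g J J'} {ψ : Cell g k H H'} {φ₁ : Cell f₁ g₁ J J'} {ψ₁ : Cell g₁ k₁ H H'}
    (hφ : tot φ = tot φ₁) (hψ : tot ψ = tot ψ₁) : tot (hcomp φ ψ) = tot (hcomp φ₁ ψ₁) := by
  obtain rfl := tot_left hφ
  obtain rfl := tot_right hφ
  obtain rfl := tot_right hψ
  rw [tot_injective hφ, tot_injective hψ]

theorem hcomp_vc {A₀ B₀ C₀ A₁ B₁ C₁ A₂ B₂ C₂ : 𝕂} {f₁ : A₀ ⟶ A₁} {g₁ : B₀ ⟶ B₁} {k₁ : C₀ ⟶ C₁}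
    {f₂ : A₁ ⟶ A₂} {g₂ : B₁ ⟶ B₂} {k₂ : C₁ ⟶ C₂} {f : A₀ ⟶ A₂} {g : B₀ ⟶ B₂} {k : C₀ ⟶ C₂}
    {J₀ : Hor A₀ B₀} {H₀ : Hor B₀ C₀}
    {J₁ : Hor A₁ B₁} {H₁ : Hor B₁ C₁} {J₂ : Hor A₂ B₂} {H₂ : Hor B₂ C₂}
    (φ₁ : Cell f₁ g₁ J₀ J₁) (ψ₁ : Cell g₁ k₁ H₀ H₁) (φ₂ : Cell f₂ g₂ J₁ J₂)
    (ψ₂ : Cell g₂ k₂ H₁ H₂) (hf : f₁ ≫ f₂ = f) (hg hg' : g₁ ≫ g₂ = g) (hk : k₁ ≫ k₂ = k) :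
    tot (hcomp (vc φ₁ φ₂ hf hg) (vc ψ₁ ψ₂ hg' hk)) = tot (hcomp φ₁ ψ₁) ≫ tot (hcomp φ₂ ψ₂) := by
  subst hf hg hk
  exact congrArg tot (interchange φ₁ ψ₁ φ₂ ψ₂)

theorem tot_hcomp_comp {A₀ B₀ C₀ A₁ B₁ C₁ A₂ B₂ C₂ : 𝕂} {f₁ : A₀ ⟶ A₁} {g₁ : B₀ ⟶ B₁}
    {k₁ : C₀ ⟶ C₁} {f₂ : A₁ ⟶ A₂} {g₂ : B₁ ⟶ B₂} {k₂ : C₁ ⟶ C₂} {f : A₀ ⟶ A₂} {g : B₀ ⟶ B₂}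
    {k : C₀ ⟶ C₂} {J₀ : Hor A₀ B₀} {H₀ : Hor B₀ C₀}
    {J₁ : Hor A₁ B₁} {H₁ : Hor B₁ C₁} {J₂ : Hor A₂ B₂} {H₂ : Hor B₂ C₂}
    {φ₁ : Cell f₁ g₁ J₀ J₁} {ψ₁ : Cell g₁ k₁ H₀ H₁} {φ₂ : Cell f₂ g₂ J₁ J₂}
    {ψ₂ : Cell g₂ k₂ H₁ H₂} {φ : Cell f g J₀ J₂} {ψ : Cell g k H₀ H₂}
    (hφ : tot φ = tot φ₁ ≫ tot φ₂) (hψ : tot ψ = tot ψ₁ ≫ tot ψ₂) :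
    tot (hcomp φ ψ) = tot (hcomp φ₁ ψ₁) ≫ tot (hcomp φ₂ ψ₂) := by
  rw [← tot_vcomp] at hφ hψ
  rw [tot_hcomp_congr hφ hψ, interchange, tot_vcomp]

theorem tot_hcomp_comp₃ {A₀ B₀ C₀ A₁ B₁ C₁ A₂ B₂ C₂ A₃ B₃ C₃ : 𝕂} {f₁ : A₀ ⟶ A₁} {g₁ : B₀ ⟶ B₁}
    {k₁ : C₀ ⟶ C₁} {f₂ : A₁ ⟶ A₂} {g₂ : B₁ ⟶ B₂} {k₂ : C₁ ⟶ C₂} {f₃ : A₂ ⟶ A₃} {g₃ : B₂ ⟶ B₃}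
    {k₃ : C₂ ⟶ C₃} {f : A₀ ⟶ A₃} {g : B₀ ⟶ B₃}
    {k : C₀ ⟶ C₃} {J₀ : Hor A₀ B₀} {H₀ : Hor B₀ C₀}
    {J₁ : Hor A₁ B₁} {H₁ : Hor B₁ C₁} {J₂ : Hor A₂ B₂} {H₂ : Hor B₂ C₂}
    {J₃ : Hor A₃ B₃} {H₃ : Hor B₃ C₃}
    {φ₁ : Cell f₁ g₁ J₀ J₁} {ψ₁ : Cell g₁ k₁ H₀ H₁} {φ₂ : Cell f₂ g₂ J₁ J₂}
    {ψ₂ : Cell g₂ k₂ H₁ H₂} {φ₃ : Cell f₃ g₃ J₂ J₃} {ψ₃ : Cell g₃ k₃ H₂ H₃}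
    {φ : Cell f g J₀ J₃} {ψ : Cell g k H₀ H₃}
    (hφ : tot φ = tot φ₁ ≫ tot φ₂ ≫ tot φ₃) (hψ : tot ψ = tot ψ₁ ≫ tot ψ₂ ≫ tot ψ₃) :
    tot (hcomp φ ψ) = tot (hcomp φ₁ ψ₁) ≫ tot (hcomp φ₂ ψ₂) ≫ tot (hcomp φ₃ ψ₃) := by
  rw [← tot_vcomp φ₂ φ₃] at hφ
  rw [← tot_vcomp ψ₂ ψ₃] at hψ
  rw [tot_hcomp_comp hφ hψ, interchange, tot_vcomp]

theorem tot_hcomp_vid (J : Hor A B) (H : Hor B C) :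
    tot (hcomp (vid J) (vid H)) = 𝟙 (⟨hor J H⟩ : HorObj 𝕂) := by
  rw [hcomp_vid, tot_vid]

theorem tot_unitCell_comp (f : A ⟶ C) (g : C ⟶ E) :
    tot (unitCell (f ≫ g)) = tot (unitCell f) ≫ tot (unitCell g) := by
  rw [unitCell_comp, tot_vcomp]

theorem tot_unitCell_id (A : 𝕂) : tot (unitCell (𝟙 A)) = 𝟙 (⟨unit A⟩ : HorObj 𝕂) := by
  rw [unitCell_id, tot_vid]

theorem tot_unitCell_of_comp {f : A ⟶ C} {g : C ⟶ E} {k : A ⟶ E} (e : f ≫ g = k) :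
    tot (unitCell f) ≫ tot (unitCell g) = tot (unitCell k) := by
  rw [← e, tot_unitCell_comp]

/-- The associator as an isomorphism in the category of cells. -/
def assocIso (J : Hor A B) (H : Hor B C) (L : Hor C D) :
    (⟨hor (hor J H) L⟩ : HorObj 𝕂) ≅ ⟨hor J (hor H L)⟩ where
  hom := tot (associator J H L)
  inv := tot (associatorInv J H L)
  hom_inv_id := tot_of_heq (associator_hom_inv J H L) (Category.comp_id _) (Category.comp_id _)
  inv_hom_id := tot_of_heq (associator_inv_hom J H L) (Category.comp_id _) (Category.comp_id _)

/-- The left unitor as an isomorphism in the category of cells. -/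
def lu (J : Hor A B) : (⟨hor (unit A) J⟩ : HorObj 𝕂) ≅ ⟨J⟩ where
  hom := tot (leftUnitor J)
  inv := tot (leftUnitorInv J)
  hom_inv_id := tot_of_heq (leftUnitor_hom_inv J) (Category.comp_id _) (Category.comp_id _)
  inv_hom_id := tot_of_heq (leftUnitor_inv_hom J) (Category.comp_id _) (Category.comp_id _)

/-- The right unitor as an isomorphism in the category of cells. -/
def ru (J : Hor A B) : (⟨hor J (unit B)⟩ : HorObj 𝕂) ≅ ⟨J⟩ where
  hom := tot (rightUnitor J)
  inv := tot (rightUnitorInv J)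
  hom_inv_id := tot_of_heq (rightUnitor_hom_inv J) (Category.comp_id _) (Category.comp_id _)
  inv_hom_id := tot_of_heq (rightUnitor_inv_hom J) (Category.comp_id _) (Category.comp_id _)

@[simp] theorem tot_associator (J : Hor A B) (H : Hor B C) (L : Hor C D) :
    tot (associator J H L) = (assocIso J H L).hom := rfl
@[simp] theorem tot_leftUnitor (J : Hor A B) : tot (leftUnitor J) = (lu J).hom := rfl
@[simp] theorem tot_leftUnitorInv (J : Hor A B) : tot (leftUnitorInv J) = (lu J).inv := rfl
@[simp] theorem tot_rightUnitor (J : Hor A B) : tot (rightUnitor J) = (ru J).hom := rfl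
@[simp] theorem tot_rightUnitorInv (J : Hor A B) : tot (rightUnitorInv J) = (ru J).inv := rfl

theorem assocIso_naturality {A' B' C' D' : 𝕂} {f : A ⟶ A'} {g : B ⟶ B'} {k : C ⟶ C'}
    {l : D ⟶ D'} {J : Hor A B} {H : Hor B C} {L : Hor C D} {J' : Hor A' B'} {H' : Hor B' C'}
    {L' : Hor C' D'} (φ : Cell f g J J') (ψ : Cell g k H H') (χ : Cell k l L L') :
    tot (hcomp (hcomp φ ψ) χ) ≫ (assocIso J' H' L').hom =
      (assocIso J H L).hom ≫ tot (hcomp φ (hcomp ψ χ)) :=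
  (tot_of_heq (associator_naturality φ ψ χ) (by simp) (by simp) :)

theorem lu_naturality (φ : Cell f g J K) :
    tot (hcomp (unitCell f) φ) ≫ (lu K).hom = (lu J).hom ≫ tot φ :=
  (tot_of_heq (leftUnitor_naturality φ) (by simp) (by simp) :)

theorem ru_naturality (φ : Cell f g J K) :
    tot (hcomp φ (unitCell g)) ≫ (ru K).hom = (ru J).hom ≫ tot φ :=
  (tot_of_heq (rightUnitor_naturality φ) (by simp) (by simp) :)

theorem lu_inv_naturality (φ : Cell f g J K) :
    (lu J).inv ≫ tot (hcomp (unitCell f) φ) = tot φ ≫ (lu K).inv := by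
  rw [Iso.inv_comp_eq, ← Category.assoc, ← lu_naturality, Category.assoc, Iso.hom_inv_id,
    Category.comp_id]

theorem ru_inv_naturality (φ : Cell f g J K) :
    (ru J).inv ≫ tot (hcomp φ (unitCell g)) = tot φ ≫ (ru K).inv := by
  rw [Iso.inv_comp_eq, ← Category.assoc, ← ru_naturality, Category.assoc, Iso.hom_inv_id,
    Category.comp_id]

theorem tot_pentagon {A B C D E : 𝕂} (J : Hor A B) (H : Hor B C) (L : Hor C D) (P : Hor D E) :
    tot (hcomp (associator J H L) (vid P)) ≫ (assocIso J (hor H L) P).hom ≫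
        tot (hcomp (vid J) (associator H L P)) =
      (assocIso (hor J H) L P).hom ≫ (assocIso J H (hor L P)).hom := by
  rw [← Category.assoc]
  exact (tot_of_heq (pentagon J H L P) (by simp) (by simp) :)

theorem tot_triangle {A B C : 𝕂} (J : Hor A B) (H : Hor B C) :
    (assocIso J (unit B) H).hom ≫ tot (hcomp (vid J) (leftUnitor H)) =
      tot (hcomp (rightUnitor J) (vid H)) :=
  (tot_of_heq (triangle J H) (by simp) (by simp) :)

theorem tot_triangle_inv {A B C : 𝕂} (J : Hor A B) (H : Hor B C) :
    tot (hcomp (rightUnitorInv J) (vid H)) ≫ (assocIso J (unit B) H).hom =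
      tot (hcomp (vid J) (leftUnitorInv H)) := by
  have e : tot (hcomp (vid J) (leftUnitor H)) ≫ tot (hcomp (vid J) (leftUnitorInv H)) =
      𝟙 (⟨hor J (hor (unit B) H)⟩ : HorObj 𝕂) := by
    rw [← tot_hcomp_comp (φ := vid J) (ψ := vid _) (by simp) (by simp), tot_hcomp_vid]
  have e' : tot (hcomp (rightUnitorInv J) (vid H)) ≫ tot (hcomp (rightUnitor J) (vid H)) =
      𝟙 (⟨hor J H⟩ : HorObj 𝕂) := by
    rw [← tot_hcomp_comp (φ := vid J) (ψ := vid _) (by simp) (by simp), tot_hcomp_vid]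
  rw [← Category.comp_id (assocIso J (unit B) H).hom, ← e, reassoc_of% tot_triangle,
    reassoc_of% e']

end Tot

end

end DoubleCategory

/-! ### Unit coherence, and the actions of vertical cells on the boundaries of cells -/

namespace DoubleCategory

section

variable {𝕂 : Type u} [DoubleCategory.{c, h, v} 𝕂] {A B C D : 𝕂}

theorem lu_whisker_faithful {J K : Hor A B} {φ ψ : Cell (𝟙 A) (𝟙 B) J K}
    (e : tot (hcomp (vid (unit A)) φ) = tot (hcomp (vid (unit A)) ψ)) : tot φ = tot ψ := by
  have h1 := lu_naturality φ
  have h2 := lu_naturality ψ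
  rw [unitCell_id] at h1 h2
  rw [← cancel_epi (lu J).hom, ← h1, ← h2, e]

theorem ru_whisker_faithful {J K : Hor A B} {φ ψ : Cell (𝟙 A) (𝟙 B) J K}
    (e : tot (hcomp φ (vid (unit B))) = tot (hcomp ψ (vid (unit B)))) : tot φ = tot ψ := by
  have h1 := ru_naturality φ
  have h2 := ru_naturality ψ
  rw [unitCell_id] at h1 h2
  rw [← cancel_epi (ru J).hom, ← h1, ← h2, e]

/-- Kelly's argument: this redundant unit axiom follows from the pentagon and the triangle once it
is whiskered with a unit, and such whiskering is faithful. -/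
theorem lu_hor (X : Hor A B) (Y : Hor B C) :
    (assocIso (unit A) X Y).hom ≫ (lu (hor X Y)).hom = tot (hcomp (leftUnitor X) (vid Y)) := by
  have inv : tot (hcomp (associatorInv (unit A) (unit A) X) (vid Y)) ≫
      tot (hcomp (associator (unit A) (unit A) X) (vid Y)) = 𝟙 _ := by
    rw [← tot_hcomp_comp (φ := vid _) (ψ := vid _), tot_hcomp_vid]
    · exact (assocIso _ _ _).inv_hom_id.symm
    · simp
  rw [← tot_leftUnitor, ← tot_associator, ← tot_vc (f'' := 𝟙 A) (g'' := 𝟙 C) _ _ (by simp) (by simp)]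
  apply lu_whisker_faithful
  rw [tot_hcomp_comp (φ₁ := vid (unit A)) (φ₂ := vid (unit A)) (ψ₁ := associator (unit A) X Y)
    (ψ₂ := leftUnitor (hor X Y)) (by simp) (by simp)]
  have main : tot (hcomp (associator (unit A) (unit A) X) (vid Y)) ≫
      (assocIso (unit A) (hor (unit A) X) Y).hom ≫ tot (hcomp (vid (unit A)) (associator (unit A) X Y))
        ≫ tot (hcomp (vid (unit A)) (leftUnitor (hor X Y))) =
      tot (hcomp (associator (unit A) (unit A) X) (vid Y)) ≫
      (assocIso (unit A) (hor (unit A) X) Y).hom ≫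
        tot (hcomp (vid (unit A)) (hcomp (leftUnitor X) (vid Y))) := by
    rw [← assocIso_naturality, reassoc_of% tot_pentagon, tot_triangle, ← Category.assoc,
      ← tot_hcomp_comp (φ := hcomp (rightUnitor (unit A)) (vid X)) (ψ := vid Y)
        (by rw [← tot_triangle]; simp) (by simp), assocIso_naturality, hcomp_vid]
  have := congrArg (fun t => (assocIso (unit A) (hor (unit A) X) Y).inv ≫
    tot (hcomp (associatorInv (unit A) (unit A) X) (vid Y)) ≫ t) main
  simpa only [reassoc_of% inv, Iso.inv_hom_id_assoc] using this

/-- Composition in $V(\mathcal K)$ is defined with left unitors and `ract` with right unitors; this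
coincidence lets a composite be read as an action on either side. -/
theorem lu_unit (A : 𝕂) : lu (unit A) = ru (unit A) := by
  ext1
  rw [← tot_leftUnitor, ← tot_rightUnitor]
  apply ru_whisker_faithful
  rw [← lu_hor, ← tot_triangle]
  congr 1
  have e := lu_naturality (leftUnitor (unit A))
  rw [unitCell_id, tot_leftUnitor, cancel_mono] at e
  exact e.symm

theorem lu_inv_hor (X : Hor A B) (Y : Hor B C) :
    (lu (hor X Y)).inv = tot (hcomp (leftUnitorInv X) (vid Y)) ≫ (assocIso (unit A) X Y).hom := by
  rw [← cancel_mono (lu (hor X Y)).hom, Iso.inv_hom_id, Category.assoc, lu_hor,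
    ← tot_hcomp_comp (φ := vid X) (ψ := vid Y) (by simp) (by simp), tot_hcomp_vid]

/-- The action of a vertical cell on the right boundary of a cell. -/
def ract {a : A ⟶ C} {b b' : B ⟶ D} {H : Hor A B} {K : Hor C D} (e : Cell a b H K)
    (α : VCell b b') : Cell a b' H K :=
  vc (vc (rightUnitorInv H) (hcomp e α) (Category.id_comp a) (Category.id_comp b'))
    (rightUnitor K) (Category.comp_id a) (Category.comp_id b')

/-- The action of a vertical cell on the left boundary of a cell. -/
def lact {a a' : A ⟶ C} {b : B ⟶ D} {H : Hor A B} {K : Hor C D} (α : VCell a a')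
    (e : Cell a' b H K) : Cell a b H K :=
  vc (vc (leftUnitorInv H) (hcomp α e) (Category.id_comp a) (Category.id_comp b))
    (leftUnitor K) (Category.comp_id a) (Category.comp_id b)

section Actions

variable {E F : 𝕂} {a a' a'' : A ⟶ C} {b b' b'' : B ⟶ D} {H : Hor A B} {K : Hor C D}

theorem tot_ract (e : Cell a b H K) (α : VCell b b') :
    tot (ract e α) = (ru H).inv ≫ tot (hcomp e α) ≫ (ru K).hom := by
  simp [ract]

theorem tot_lact (α : VCell a a') (e : Cell a' b H K) :
    tot (lact α e) = (lu H).inv ≫ tot (hcomp α e) ≫ (lu K).hom := by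
  simp [lact]

theorem VCell.tot_comp {f g k : A ⟶ C} (φ : VCell f g) (ψ : VCell g k) :
    tot (φ ≫ᵥ ψ) = (lu (unit A)).inv ≫ tot (hcomp φ ψ) ≫ (lu (unit C)).hom := by
  simp [VCell.comp, tot_recast]

theorem VCell.comp_eq_ract {f g k : A ⟶ C} (φ : VCell f g) (ψ : VCell g k) :
    φ ≫ᵥ ψ = ract φ ψ := by
  apply tot_injective
  rw [VCell.tot_comp, tot_ract, lu_unit, lu_unit]

theorem VCell.comp_eq_lact {f g k : A ⟶ C} (φ : VCell f g) (ψ : VCell g k) :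
    φ ≫ᵥ ψ = lact φ ψ := by
  apply tot_injective
  rw [VCell.tot_comp, tot_lact]

@[simp] theorem ract_unitCell (e : Cell a b H K) : ract e (unitCell b) = e := by
  apply tot_injective
  rw [tot_ract, ru_naturality, Iso.inv_hom_id_assoc]

@[simp] theorem lact_unitCell (e : Cell a b H K) : lact (unitCell a) e = e := by
  apply tot_injective
  rw [tot_lact, lu_naturality, Iso.inv_hom_id_assoc]

theorem ract_comp (e : Cell a b H K) (α : VCell b b') (β : VCell b' b'') :
    ract e (α ≫ᵥ β) = ract (ract e α) β := by
  apply tot_injective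
  rw [tot_ract, tot_ract]
  have h1 : tot (hcomp e (α ≫ᵥ β)) = tot (hcomp (vid H) (leftUnitorInv (unit B))) ≫
      tot (hcomp e (hcomp α β)) ≫ tot (hcomp (vid K) (leftUnitor (unit D))) :=
    tot_hcomp_comp₃ (by simp) (VCell.tot_comp _ _)
  have h2 : tot (hcomp (ract e α) β) = tot (hcomp (rightUnitorInv H) (vid (unit B))) ≫
      tot (hcomp (hcomp e α) β) ≫ tot (hcomp (rightUnitor K) (vid (unit D))) :=
    tot_hcomp_comp₃ (tot_ract _ _) (by simp)
  rw [h1, h2, ← tot_triangle, ← tot_triangle_inv]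
  simp only [Category.assoc]
  rw [reassoc_of% assocIso_naturality]

theorem lact_comp (α : VCell a a') (β : VCell a' a'') (e : Cell a'' b H K) :
    lact (α ≫ᵥ β) e = lact α (lact β e) := by
  apply tot_injective
  rw [tot_lact, tot_lact]
  have h1 : tot (hcomp (α ≫ᵥ β) e) = tot (hcomp (rightUnitorInv (unit A)) (vid H)) ≫
      tot (hcomp (hcomp α β) e) ≫ tot (hcomp (rightUnitor (unit C)) (vid K)) :=
    tot_hcomp_comp₃ (by rw [VCell.tot_comp, lu_unit, lu_unit]; rfl) (by simp)
  have h2 : tot (hcomp α (lact β e)) = tot (hcomp (vid (unit A)) (leftUnitorInv H)) ≫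
      tot (hcomp α (hcomp β e)) ≫ tot (hcomp (vid (unit C)) (leftUnitor K)) :=
    tot_hcomp_comp₃ (by simp) (tot_lact _ _)
  rw [h1, h2, ← tot_triangle, ← tot_triangle_inv]
  simp only [Category.assoc]
  rw [reassoc_of% assocIso_naturality]

theorem ract_vc {f : C ⟶ E} {g : D ⟶ F} {L : Hor E F} (e : Cell a b H K) (σ : Cell f g K L)
    (α : VCell b b') {c : A ⟶ E} {d d' : B ⟶ F} (hc : a ≫ f = c) (hd hd₁ : b ≫ g = d)
    (hd' : b' ≫ g = d') :
    ract (vc e σ hc hd) (vc α (unitCell g) hd₁ hd') = vc (ract e α) σ hc hd' := by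
  apply tot_injective
  rw [tot_ract, hcomp_vc, tot_vc, tot_ract]
  simp only [Category.assoc]
  rw [ru_naturality]

theorem lact_vc {f : C ⟶ E} {g : D ⟶ F} {L : Hor E F} (e : Cell a' b H K) (σ : Cell f g K L)
    (α : VCell a a') {c c' : A ⟶ E} {d : B ⟶ F} (hc : a ≫ f = c) (hd : b ≫ g = d)
    (hc' hc₁ : a' ≫ f = c') :
    lact (vc α (unitCell f) hc hc') (vc e σ hc₁ hd) = vc (lact α e) σ hc hd := by
  apply tot_injective
  rw [tot_lact, hcomp_vc, tot_vc, tot_lact]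
  simp only [Category.assoc]
  rw [lu_naturality]

theorem vc_ract {X Y : 𝕂} {l : X ⟶ A} {k : Y ⟶ B} {G : Hor X Y} (θ : Cell l k G H)
    (e : Cell a b H K) (α : VCell b b') {c : X ⟶ C} {d d' : Y ⟶ D} (hc : l ≫ a = c)
    (hd hd₁ : k ≫ b = d) (hd' : k ≫ b' = d') :
    ract (vc θ e hc hd) (vc (unitCell k) α hd₁ hd') = vc θ (ract e α) hc hd' := by
  apply tot_injective
  rw [tot_ract, hcomp_vc, tot_vc, tot_ract, Category.assoc, reassoc_of% ru_inv_naturality]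

/-- Interchange: pasting $\xi$ below a cell into a unit amounts to applying the source of $\xi$ to
that cell and then acting with $\xi n$ on the right boundary. The companion statement for `lact`
uses $\xi m$ first and the target of $\xi$ afterwards; together they express naturality of $\xi$. -/
theorem vc_eq_ract {M N : 𝕂} {m : A ⟶ M} {n : B ⟶ M} {f g : M ⟶ N} (e : Cell m n H (unit M))
    (ξ : VCell f g) {c : A ⟶ N} {d d' : B ⟶ N} (hc : m ≫ f = c) (hd : n ≫ f = d)
    (hd' : n ≫ g = d') :
    ract (vc e (unitCell f) hc hd) (vc (unitCell n) ξ hd hd') = vc e ξ hc hd' := by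
  apply tot_injective
  rw [tot_ract, hcomp_vc, tot_vc, Category.assoc, reassoc_of% ru_inv_naturality, ← lu_unit M,
    ← lu_unit N, lu_naturality, Iso.inv_hom_id_assoc]

theorem vc_eq_lact {M N : 𝕂} {m : A ⟶ M} {n : B ⟶ M} {f g : M ⟶ N} (e : Cell m n H (unit M))
    (ξ : VCell f g) {c c' : A ⟶ N} {d : B ⟶ N} (hc : m ≫ f = c) (hd : n ≫ g = d)
    (hc' : m ≫ g = c') :
    lact (vc (unitCell m) ξ hc hc') (vc e (unitCell g) hc' hd) = vc e ξ hc hd := by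
  apply tot_injective
  rw [tot_lact, hcomp_vc, tot_vc, Category.assoc, reassoc_of% lu_inv_naturality, lu_unit M,
    lu_unit N, ru_naturality, Iso.inv_hom_id_assoc]

theorem ract_ofEq (e : Cell a b H K) (hb : b = b') :
    ract e (VCell.ofEq hb) = cst e rfl hb := by
  subst hb
  exact ract_unitCell e

theorem tot_ract_congr {e : Cell a b H K} {b₁ b₁' : B ⟶ D} {e₁ : Cell a' b₁ H K}
    {α : VCell b b'} {α₁ : VCell b₁ b₁'} (he : tot e = tot e₁) (hα : tot α = tot α₁) :
    tot (ract e α) = tot (ract e₁ α₁) := by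
  rw [tot_ract, tot_ract, tot_hcomp_congr he hα]

end Actions

end

end DoubleCategory

/-! ### Cartesian cells and companions -/

namespace DoubleCategory

section

variable {𝕂 : Type u} [DoubleCategory.{c, h, v} 𝕂] {A B C D E F : 𝕂}

namespace IsCartesian

variable {f : A ⟶ C} {g : B ⟶ D} {J : Hor A B} {K : Hor C D} {φ : Cell f g J K}

theorem exists_vc (hφ : IsCartesian φ) {X Y : 𝕂} {l : X ⟶ A} {k : Y ⟶ B} {H : Hor X Y}
    {a : X ⟶ C} {b : Y ⟶ D} (χ : Cell a b H K) (ha : l ≫ f = a) (hb : k ≫ g = b) :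
    ∃ ψ : Cell l k H J, tot ψ ≫ tot φ = tot χ := by
  subst ha hb
  obtain ⟨ψ, hψ, -⟩ := hφ l k H χ
  exact ⟨ψ, by rw [← hψ, tot_vcomp]⟩

theorem cancel (hφ : IsCartesian φ) {X Y : 𝕂} {l : X ⟶ A} {k : Y ⟶ B} {H : Hor X Y}
    {ψ ψ' : Cell l k H J} (e : tot ψ ≫ tot φ = tot ψ' ≫ tot φ) : ψ = ψ' :=
  (hφ l k H (vcomp ψ' φ)).unique (tot_injective e) rfl

theorem mk (ex : ∀ ⦃X Y : 𝕂⦄ (l : X ⟶ A) (k : Y ⟶ B) (H : Hor X Y) (χ : Cell (l ≫ f) (k ≫ g) H K),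
      ∃ ψ : Cell l k H J, tot ψ ≫ tot φ = tot χ)
    (un : ∀ ⦃X Y : 𝕂⦄ (l : X ⟶ A) (k : Y ⟶ B) (H : Hor X Y) (ψ ψ' : Cell l k H J),
      tot ψ ≫ tot φ = tot ψ' ≫ tot φ → tot ψ = tot ψ') : IsCartesian φ := by
  intro X Y l k H χ
  obtain ⟨ψ, hψ⟩ := ex l k H χ
  refine ⟨ψ, tot_injective hψ, fun ψ' hψ' => tot_injective (un _ _ _ _ _ ?_)⟩
  rw [hψ, ← hψ', tot_vcomp]

theorem of_tot_comp {f' : C ⟶ E} {g' : D ⟶ F} {L : Hor E F} {ψ : Cell f' g' K L} {f'' : A ⟶ E}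
    {g'' : B ⟶ F} {χ : Cell f'' g'' J L} (hφ : IsCartesian φ) (hψ : IsCartesian ψ)
    (hf : f ≫ f' = f'') (hg : g ≫ g' = g'') (e : tot χ = tot φ ≫ tot ψ) : IsCartesian χ := by
  subst hf hg
  refine mk (fun X Y l k H ω => ?_) (fun X Y l k H ω ω' h => ?_)
  · obtain ⟨ω₁, h₁⟩ := hψ.exists_vc ω (Category.assoc l f f') (Category.assoc k g g')
    obtain ⟨ω₂, h₂⟩ := hφ.exists_vc ω₁ rfl rfl
    exact ⟨ω₂, by rw [e, reassoc_of% h₂, h₁]⟩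
  · rw [e, ← Category.assoc, ← Category.assoc, ← tot_vcomp, ← tot_vcomp ω'] at h
    have h' := hψ.cancel (ψ := vcomp ω φ) (ψ' := vcomp ω' φ) h
    rw [hφ.cancel (ψ := ω) (ψ' := ω') (congrArg tot h')]

end IsCartesian

/-- A companion of `f` is accompanied by a cell from the unit. -/
theorem exists_companionUnit {f : A ⟶ C} {J : Hor A C} {ε : Cell f (𝟙 C) J (unit C)}
    (hε : IsCartesian ε) : ∃ η : Cell (𝟙 A) f (unit A) J, tot η ≫ tot ε = tot (unitCell f) :=
  hε.exists_vc (unitCell f) (Category.id_comp f) (Category.comp_id f)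

/-- The second triangle identity of a companion comes for free from the first: the pasted
endomorphism of $J$ and the identity agree after composing with the cartesian $\varepsilon$. -/
theorem companion_identity {f : A ⟶ C} {J : Hor A C} {ε : Cell f (𝟙 C) J (unit C)}
    (hε : IsCartesian ε) {η : Cell (𝟙 A) f (unit A) J} (hη : tot η ≫ tot ε = tot (unitCell f)) :
    tot (hcomp η ε) = (lu J).hom ≫ (ru J).inv := by
  rw [Iso.eq_comp_inv, ← cancel_epi (lu J).inv, Iso.inv_hom_id]
  have : vc (vc (leftUnitorInv J) (hcomp η ε) (Category.id_comp _) (Category.id_comp _))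
      (rightUnitor J) (Category.id_comp _) (Category.id_comp _) = vid J := by
    apply hε.cancel
    rw [tot_vc, tot_vc]
    simp only [Category.assoc, tot_leftUnitorInv, tot_rightUnitor, tot_vid, Category.id_comp]
    rw [← ru_naturality, unitCell_id, ← reassoc_of% tot_hcomp_comp (φ := unitCell f) (ψ := ε) hη.symm
      (by simp), ← lu_unit, lu_naturality, Iso.inv_hom_id_assoc]
  rw [← tot_vid, ← this, tot_vc, tot_vc]
  simp

/-- This exhibits $f_*\odot K$ as the restriction $K(f,\mathrm{id})$. Factorisations are obtained by
pasting $\eta$ on the left; the first triangle identity shows that they factor, and the second one,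
in the form `key`, that they are unique. -/
theorem isCartesian_companion_hor {f : A ⟶ C} {J : Hor A C} {ε : Cell f (𝟙 C) J (unit C)}
    (hε : IsCartesian ε) (K : Hor C D) :
    IsCartesian (vc (hcomp ε (vid K)) (leftUnitor K) (Category.comp_id f) (Category.comp_id (𝟙 D))) := by
  obtain ⟨η, hη⟩ := exists_companionUnit hε
  have key : (lu (hor J K)).inv ≫ tot (hcomp η
      (vc (hcomp ε (vid K)) (leftUnitor K) (Category.comp_id f) (Category.comp_id (𝟙 D)))) = 𝟙 _ := by
    rw [tot_hcomp_comp (φ₁ := η) (ψ₁ := hcomp ε (vid K)) (φ₂ := vid J) (ψ₂ := leftUnitor K)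
      (by simp) (by simp), lu_inv_hor]
    simp only [Category.assoc]
    rw [← reassoc_of% assocIso_naturality, tot_triangle, ← tot_hcomp_comp₃ (φ := vid J) (ψ := vid K) _ _,
      tot_hcomp_vid]
    · rw [companion_identity hε hη]; simp
    · simp
  refine IsCartesian.mk (fun X Y l k H χ => ?_) (fun X Y l k H ψ ψ' h => ?_)
  · refine ⟨vc (leftUnitorInv H) (hcomp (vc (unitCell l) η (Category.comp_id l) rfl)
      (cst χ rfl (Category.comp_id k)))
      (Category.id_comp l) (Category.id_comp k), ?_⟩
    rw [tot_vc, tot_vc, tot_leftUnitorInv, Category.assoc,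
      ← reassoc_of% tot_hcomp_comp (φ := unitCell (l ≫ f)) (ψ := cst χ rfl (Category.comp_id k)) _ _]
    · rw [tot_leftUnitor, lu_naturality, Iso.inv_hom_id_assoc, tot_cst]
    · rw [tot_vc, Category.assoc, hη, tot_unitCell_comp]
    · simp
  · have aux : ∀ ψ : Cell l k H (hor J K), tot ψ = (lu H).inv ≫
        tot (hcomp (vc (unitCell l) η (Category.comp_id l) rfl) (vcomp ψ
        (vc (hcomp ε (vid K)) (leftUnitor K) (Category.comp_id f) (Category.comp_id (𝟙 D))))) := by
      intro ψ
      rw [tot_hcomp_comp (tot_vc _ _ _ _) (tot_vcomp _ _), reassoc_of% lu_inv_naturality, key,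
        Category.comp_id]
    rw [aux ψ, aux ψ']
    congr 1
    exact tot_hcomp_congr rfl h

end

end DoubleCategory

/-! ### Lax double functors out of an equipment preserve cartesian cells -/

namespace LaxDoubleFunctor

variable {𝕂 : Type u} [DoubleCategory.{c, h, v} 𝕂] {𝕃 : Type u} [DoubleCategory.{c, h, v} 𝕃]
  (T : LaxDoubleFunctor 𝕂 𝕃) {A B C D : 𝕂}

/-- The action of a lax double functor on the category of cells. -/
def mapTot {J : Hor A B} {K : Hor C D} (φ : (⟨J⟩ : HorObj 𝕂) ⟶ ⟨K⟩) :
    (⟨T.mapHor J⟩ : HorObj 𝕃) ⟶ ⟨T.mapHor K⟩ :=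
  (⟨T.map (HorHom.left φ), T.map (HorHom.right φ), T.mapCell (HorHom.cell φ)⟩ : HorHom _ _)

theorem mapTot_id (J : Hor A B) : T.mapTot (𝟙 (⟨J⟩ : HorObj 𝕂)) = 𝟙 _ :=
  cell_heq_rfl (T.map_id _) (T.map_id _) (T.mapCell_vid J)

theorem mapTot_comp {X Y : 𝕂} {J : Hor A B} {K : Hor C D} {L : Hor X Y}
    (φ : (⟨J⟩ : HorObj 𝕂) ⟶ ⟨K⟩) (ψ : (⟨K⟩ : HorObj 𝕂) ⟶ ⟨L⟩) :
    T.mapTot (φ ≫ ψ) = T.mapTot φ ≫ T.mapTot ψ :=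
  cell_heq_rfl (T.map_comp _ _) (T.map_comp _ _)
    (T.mapCell_vcomp (HorHom.cell φ) (HorHom.cell ψ))

theorem tot_mapCell {f : A ⟶ C} {g : B ⟶ D} {J : Hor A B} {K : Hor C D} (φ : Cell f g J K) :
    tot (T.mapCell φ) = T.mapTot (tot φ) := rfl

theorem tot_compositor_naturality {A' B' C' : 𝕂} {f : A ⟶ A'} {g : B ⟶ B'} {k : C ⟶ C'}
    {J : Hor A B} {H : Hor B C} {J' : Hor A' B'} {H' : Hor B' C'}
    (φ : Cell f g J J') (ψ : Cell g k H H') :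
    tot (hcomp (T.mapCell φ) (T.mapCell ψ)) ≫ tot (T.compositor J' H') =
      tot (T.compositor J H) ≫ T.mapTot (tot (hcomp φ ψ)) :=
  (tot_of_heq (T.compositor_naturality φ ψ) (by simp) (by simp) :)

theorem tot_unitor_naturality (f : A ⟶ C) :
    tot (unitCell (T.map f)) ≫ tot (T.unitor C) = tot (T.unitor A) ≫ T.mapTot (tot (unitCell f)) :=
  (tot_of_heq (T.unitor_naturality f) (by simp) (by simp) :)

theorem tot_compositor_leftUnitor (J : Hor A B) :
    tot (hcomp (T.unitor A) (vid (T.mapHor J))) ≫ tot (T.compositor (unit A) J) ≫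
      T.mapTot (lu J).hom = (lu (T.mapHor J)).hom := by
  rw [← Category.assoc]
  exact (tot_of_heq (T.compositor_leftUnitor J) (by simp) (by simp) :)

theorem tot_compositor_rightUnitor (J : Hor A B) :
    tot (hcomp (vid (T.mapHor J)) (T.unitor B)) ≫ tot (T.compositor J (unit B)) ≫
      T.mapTot (ru J).hom = (ru (T.mapHor J)).hom := by
  rw [← Category.assoc]
  exact (tot_of_heq (T.compositor_rightUnitor J) (by simp) (by simp) :)

theorem lu_inv_compositor (J : Hor A B) :
    (lu (T.mapHor J)).inv ≫ tot (hcomp (T.unitor A) (vid (T.mapHor J))) ≫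
      tot (T.compositor (unit A) J) = T.mapTot (lu J).inv := by
  rw [Iso.inv_comp_eq, ← tot_compositor_leftUnitor]
  simp only [Category.assoc]
  rw [← mapTot_comp, Iso.hom_inv_id, mapTot_id, Category.comp_id]

theorem ru_inv_compositor (J : Hor A B) :
    (ru (T.mapHor J)).inv ≫ tot (hcomp (vid (T.mapHor J)) (T.unitor B)) ≫
      tot (T.compositor J (unit B)) = T.mapTot (ru J).inv := by
  rw [Iso.inv_comp_eq, ← tot_compositor_rightUnitor]
  simp only [Category.assoc]
  rw [← mapTot_comp, Iso.hom_inv_id, mapTot_id, Category.comp_id]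

theorem lu_inv_hcomp_unitor {X Y : 𝕃} {a : X ⟶ T.obj A} {b : Y ⟶ T.obj B} {H : Hor X Y}
    {K : Hor A B} (χ : Cell a b H (T.mapHor K)) :
    (lu H).inv ≫ tot (hcomp (vc (unitCell a) (T.unitor A) (Category.comp_id a) (Category.comp_id a)) χ)
      ≫ tot (T.compositor (unit A) K) ≫ T.mapTot (lu K).hom = tot χ := by
  rw [tot_hcomp_comp (φ₁ := unitCell a) (ψ₁ := χ) (φ₂ := T.unitor A) (ψ₂ := vid _) (tot_vc _ _ _ _)
    (by simp), Category.assoc, tot_compositor_leftUnitor, lu_naturality, Iso.inv_hom_id_assoc]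

theorem ru_inv_hcomp_unitor {X Y : 𝕃} {a : X ⟶ T.obj A} {b : Y ⟶ T.obj B} {H : Hor X Y}
    {K : Hor A B} (χ : Cell a b H (T.mapHor K)) :
    (ru H).inv ≫ tot (hcomp χ (vc (unitCell b) (T.unitor B) (Category.comp_id b) (Category.comp_id b)))
      ≫ tot (T.compositor K (unit B)) ≫ T.mapTot (ru K).hom = tot χ := by
  rw [tot_hcomp_comp (φ₁ := χ) (ψ₁ := unitCell b) (φ₂ := vid _) (ψ₂ := T.unitor B) (by simp)
    (tot_vc _ _ _ _), Category.assoc, tot_compositor_rightUnitor, ru_naturality,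
    Iso.inv_hom_id_assoc]

theorem tot_unitor_recast {X Y : 𝕃} {J J' : Hor X Y} (e : J' = J) (u : Cell (𝟙 X) (𝟙 Y) J J')
    (hu : HEq u (vid J)) :
    tot u ≫ tot (recast rfl rfl e.symm rfl (vid J)) = 𝟙 (⟨J⟩ : HorObj 𝕃) ∧
      tot (recast rfl rfl e.symm rfl (vid J)) ≫ tot u = 𝟙 (⟨J'⟩ : HorObj 𝕃) := by
  subst e
  rw [eq_of_heq hu]
  exact ⟨Category.comp_id _, Category.comp_id _⟩

variable {T}

/-- The inverse of the unitor of a normal lax double functor. -/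
def IsNormal.unitorInv (hT : T.IsNormal) (A : 𝕂) :
    Cell (𝟙 (T.obj A)) (𝟙 (T.obj A)) (T.mapHor (unit A)) (unit (T.obj A)) :=
  recast rfl rfl (hT.mapHor_unit A).symm rfl (vid _)

/-- The unitor of a normal lax double functor, as an isomorphism in the category of cells. -/
def IsNormal.unitorIso (hT : T.IsNormal) (A : 𝕂) :
    (⟨unit (T.obj A)⟩ : HorObj 𝕃) ≅ ⟨T.mapHor (unit A)⟩ where
  hom := tot (T.unitor A)
  inv := tot (hT.unitorInv A)
  hom_inv_id := (tot_unitor_recast (hT.mapHor_unit A) _ (hT.unitor_eq A)).1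
  inv_hom_id := (tot_unitor_recast (hT.mapHor_unit A) _ (hT.unitor_eq A)).2

/-- Normal lax double functors between equipments preserve cartesian cells. -/
theorem isCartesian_mapCell (h𝕂 : IsEquipment 𝕂) {f : A ⟶ C} {g : B ⟶ D}
    {J : Hor A B} {K : Hor C D} {φ : Cell f g J K} (hφ : IsCartesian φ) :
    IsCartesian (T.mapCell φ) := by
  -- The restriction $K(f,g)$ is compared with $f_*\odot K\odot g^*$: here $F = f_*$ is a companion,
  -- $G = g^*$ a conjoint, and $s$ is the comparison into $J$. These data are made of cells and
  -- equations only, so $T$ transports them, the compositors and unitors pointing in the needed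
  -- direction.
  obtain ⟨F, εf, hεf⟩ := h𝕂 f (unit C) (𝟙 C)
  obtain ⟨ηf, hηf⟩ := exists_companionUnit hεf
  obtain ⟨G, εg, hεg⟩ := h𝕂 (𝟙 D) (unit D) g
  obtain ⟨ηg, hηg⟩ := hεg.exists_vc (unitCell g) (Category.comp_id g) (Category.id_comp g)
  let E₁ : Cell f (𝟙 D) (hor F K) K :=
    vc (hcomp εf (vid K)) (leftUnitor K) (Category.comp_id _) (Category.comp_id _)
  let E₂ : Cell f g (hor (hor F K) G) K :=
    vc (hcomp E₁ εg) (rightUnitor K) (Category.comp_id _) (Category.comp_id _)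
  have hE₁ : tot E₁ = tot (hcomp εf (vid K)) ≫ (lu K).hom := tot_vc _ _ _ _
  have hE₂ : tot E₂ = tot (hcomp E₁ εg) ≫ (ru K).hom := tot_vc _ _ _ _
  obtain ⟨s, hs⟩ := hφ.exists_vc E₂ (Category.id_comp f) (Category.id_comp g)
  let Lf : Cell (𝟙 _) (T.map f) (unit (T.obj A)) (T.mapHor F) :=
    vc (T.unitor A) (T.mapCell ηf) (by simp) (by simp)
  let Lg : Cell (T.map g) (𝟙 _) (unit (T.obj B)) (T.mapHor G) :=
    vc (T.unitor B) (T.mapCell ηg) (by simp) (by simp)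
  have hLf : tot Lf = tot (T.unitor A) ≫ T.mapTot (tot ηf) := tot_vc _ _ _ _
  have hLg : tot Lg = tot (T.unitor B) ≫ T.mapTot (tot ηg) := tot_vc _ _ _ _
  have hLfε : tot Lf ≫ T.mapTot (tot εf) = tot (unitCell (T.map f)) ≫ tot (T.unitor C) := by
    rw [hLf, Category.assoc, ← mapTot_comp, hηf, tot_unitor_naturality]
  have hLgε : tot Lg ≫ T.mapTot (tot εg) = tot (unitCell (T.map g)) ≫ tot (T.unitor D) := by
    rw [hLg, Category.assoc, ← mapTot_comp, hηg, tot_unitor_naturality]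
  refine IsCartesian.mk (fun X Y l k H χ => ?_) (fun X Y l k H => ?_)
  -- Existence: paste the images of the companion and conjoint units on both sides of $\chi$, apply
  -- the compositors, and end with $Ts$.
  · let N₁ : Cell l (k ≫ T.map g) H (T.mapHor (hor F K)) :=
      vc (vc (leftUnitorInv H) (hcomp (vc (unitCell l) Lf (Category.comp_id _) rfl) χ)
        (Category.id_comp _) (Category.id_comp _)) (T.compositor F K) (Category.comp_id _)
        (Category.comp_id _)
    have hN₁ : tot N₁ = (lu H).inv ≫ tot (hcomp (vc (unitCell l) Lf (Category.comp_id _) rfl) χ) ≫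
        tot (T.compositor F K) := by simp [N₁]
    have hN₁E : tot N₁ ≫ T.mapTot (tot E₁) = tot χ := by
      rw [hN₁, hE₁, mapTot_comp]
      simp only [Category.assoc]
      rw [← reassoc_of% tot_compositor_naturality, ← reassoc_of% tot_hcomp_comp
        (φ := vc (unitCell (l ≫ T.map f)) (T.unitor C) (Category.comp_id _) (Category.comp_id _))
        (ψ := χ) _ _, lu_inv_hcomp_unitor]
      · rw [tot_vc, tot_vc, Category.assoc, tot_mapCell, hLfε, ← Category.assoc,
          tot_unitCell_of_comp rfl]
      · rw [tot_mapCell, tot_vid, mapTot_id, Category.comp_id]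
    let N₂ : Cell l k H (T.mapHor J) :=
      vc (vc (vc (rightUnitorInv H) (hcomp N₁ (vc (unitCell k) Lg rfl (Category.comp_id _)))
        (Category.id_comp _) (Category.id_comp _)) (T.compositor (hor F K) G) (Category.comp_id _)
        (Category.comp_id _)) (T.mapCell s) (by simp) (by simp)
    have hN₂ : tot N₂ = (ru H).inv ≫ tot (hcomp N₁ (vc (unitCell k) Lg rfl (Category.comp_id _))) ≫
        tot (T.compositor (hor F K) G) ≫ T.mapTot (tot s) := by simp [N₂, tot_mapCell]
    refine ⟨N₂, ?_⟩
    rw [hN₂, tot_mapCell]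
    simp only [Category.assoc]
    rw [← mapTot_comp, hs, hE₂, mapTot_comp]
    rw [← reassoc_of% tot_compositor_naturality, ← reassoc_of% tot_hcomp_comp (φ := χ)
      (ψ := vc (unitCell (k ≫ T.map g)) (T.unitor D) (Category.comp_id _) (Category.comp_id _)) _ _,
      ru_inv_hcomp_unitor]
    · exact hN₁E.symm
    · rw [tot_vc, tot_vc, Category.assoc, tot_mapCell, hLgε, ← Category.assoc,
        tot_unitCell_of_comp rfl]
  -- Uniqueness: $M_2$ is the same construction before applying $T$, performed on $\phi$ itself, and
  -- is the identity since $\phi$ is cartesian. Applying $T$ to this equation shows that the formula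
  -- used for existence recovers $\psi$ from its composite with $T\phi$.
  · let M₁ : Cell (𝟙 A) g J (hor F K) := vc (leftUnitorInv J) (hcomp ηf φ) (Category.comp_id _)
      (Category.id_comp _)
    have hM₁ : tot M₁ = (lu J).inv ≫ tot (hcomp ηf φ) := tot_vc _ _ _ _
    have hM₁E : tot M₁ ≫ tot E₁ = tot φ := by
      rw [hM₁, hE₁, Category.assoc, ← reassoc_of% tot_hcomp_comp (φ := unitCell f) (ψ := φ) hηf.symm
        (by simp), lu_naturality, Iso.inv_hom_id_assoc]
    let M₂ : Cell (𝟙 A) (𝟙 B) J J := vc (vc (rightUnitorInv J) (hcomp M₁ ηg) (Category.comp_id _)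
      (Category.id_comp _)) s (Category.comp_id _) (Category.id_comp _)
    have hM₂ : tot M₂ = (ru J).inv ≫ tot (hcomp M₁ ηg) ≫ tot s := by simp [M₂]
    have hM₂' : tot M₂ = 𝟙 _ := by
      rw [← tot_vid]
      congr 1
      apply hφ.cancel
      rw [hM₂, Category.assoc, Category.assoc, hs, hE₂, ← reassoc_of% tot_hcomp_comp (φ := φ)
        (ψ := unitCell g) hM₁E.symm hηg.symm, ru_naturality, Iso.inv_hom_id_assoc, tot_vid,
        Category.id_comp]
    let N₁ (χ : Cell (l ≫ T.map f) (k ≫ T.map g) H (T.mapHor K)) :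
        Cell l (k ≫ T.map g) H (T.mapHor (hor F K)) :=
      vc (vc (leftUnitorInv H) (hcomp (vc (unitCell l) Lf (Category.comp_id _) rfl) χ)
        (Category.id_comp _) (Category.id_comp _)) (T.compositor F K) (Category.comp_id _)
        (Category.comp_id _)
    have hN₁ (χ) : tot (N₁ χ) = (lu H).inv ≫
        tot (hcomp (vc (unitCell l) Lf (Category.comp_id _) rfl) χ) ≫
        tot (T.compositor F K) := by simp [N₁]
    have key (ψ : Cell l k H (T.mapHor J)) : tot ψ = (ru H).inv ≫ tot (hcomp
        (N₁ (vcomp ψ (T.mapCell φ))) (vc (unitCell k) Lg rfl (Category.comp_id _))) ≫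
        tot (T.compositor (hor F K) G) ≫ T.mapTot (tot s) := by
      have h₁ : tot (N₁ (vcomp ψ (T.mapCell φ))) = tot ψ ≫ T.mapTot (tot M₁) := by
        rw [hN₁, tot_hcomp_comp₃ (φ₁ := unitCell l) (ψ₁ := ψ) (φ₂ := T.unitor A) (ψ₂ := vid _)
          (φ₃ := T.mapCell ηf) (ψ₃ := T.mapCell φ) (by rw [tot_vc, hLf]; rfl) (by simp)]
        simp only [Category.assoc]
        rw [reassoc_of% lu_inv_naturality, tot_compositor_naturality, hM₁, mapTot_comp,
          ← lu_inv_compositor]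
        simp only [Category.assoc]
      rw [tot_hcomp_comp₃ (φ₁ := ψ) (ψ₁ := unitCell k) (φ₂ := vid _) (ψ₂ := T.unitor B)
          (φ₃ := T.mapCell M₁) (ψ₃ := T.mapCell ηg) (by rw [h₁]; simp [tot_mapCell])
          (by rw [tot_vc, hLg]; rfl)]
      simp only [Category.assoc]
      rw [reassoc_of% ru_inv_naturality, reassoc_of% tot_compositor_naturality,
        reassoc_of% ru_inv_compositor, ← mapTot_comp, ← mapTot_comp, ← hM₂, hM₂', mapTot_id,
        Category.comp_id]
    intro ψ ψ' e
    have e' : vcomp ψ (T.mapCell φ) = vcomp ψ' (T.mapCell φ) := tot_injective e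
    rw [key ψ, key ψ', e']

end LaxDoubleFunctor

/-! ### Kan extensions, the Yoneda argument and relative adjunctions -/

namespace DoubleCategory

section

variable {𝕂 : Type u} [DoubleCategory.{c, h, v} 𝕂] {A B C D M N X Y : 𝕂}

theorem isCartesian_of_inverse {J K : Hor A B} {φ : Cell (𝟙 A) (𝟙 B) J K} {ψ : Cell (𝟙 A) (𝟙 B) K J}
    (h₁ : tot φ ≫ tot ψ = 𝟙 _) (h₂ : tot ψ ≫ tot φ = 𝟙 _) : IsCartesian φ := by
  refine IsCartesian.mk (fun X Y l k H χ => ⟨vc χ ψ (by simp) (by simp), ?_⟩)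
    (fun X Y l k H ω ω' e => ?_)
  · rw [tot_vc, Category.assoc, h₂, Category.comp_id]
  · rw [← Category.comp_id (tot ω), ← h₁, reassoc_of% e, h₁, Category.comp_id]

theorem tot_ract_of_comp {p : X ⟶ A} {q : Y ⟶ B} {G : Hor X Y} {H : Hor A B} {K : Hor C D}
    {a : A ⟶ C} {b b' : B ⟶ D} {c : X ⟶ C} {d d' : Y ⟶ D} {θ : Cell p q G H} {e : Cell a b H K}
    {e₁ : Cell c d G K} {α : VCell b b'} {α₁ : VCell d d'} (he : tot e₁ = tot θ ≫ tot e)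
    (hα : tot α₁ = tot (unitCell q) ≫ tot α) : tot (ract e₁ α₁) = tot θ ≫ tot (ract e α) := by
  rw [← tot_vc θ (ract e α) rfl rfl, ← vc_ract θ e α rfl rfl rfl rfl]
  exact tot_ract_congr (by rw [tot_vc, he]) (by rw [tot_vc, hα])

/-- Cells into a unit whose right boundary is an identity absorb vertical cells. -/
theorem tot_ract_of_id {m : X ⟶ M} {n : M ⟶ M} (hn : n = 𝟙 M) {H : Hor X M}
    (e : Cell m n H (unit M)) {g : M ⟶ M} (ξ : VCell n g) :
    tot (ract e ξ) = tot e ≫ tot ξ := by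
  subst hn
  rw [← tot_vc e ξ (Category.comp_id m) (Category.id_comp g), ← vc_eq_ract e ξ (Category.comp_id m)
    (Category.comp_id _) (Category.id_comp g)]
  exact tot_ract_congr (by simp [tot_unitCell_id]) (by simp [tot_unitCell_id])

section Kan

variable {d : A ⟶ M} {l : B ⟶ M} {J : Hor A B} {η : Cell d l J (unit M)}

theorem ract_eq_iff (k : B ⟶ M) (α : VCell l k) (e : Cell d k J (unit M)) :
    ract η α = e ↔ HEq (vcomp (hcomp η α) (leftUnitor (unit M)))
      (vc (rightUnitor J) e (Category.id_comp d) (Category.id_comp k)) := by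
  rw [← tot_inj, tot_ract, Iso.inv_comp_eq, ← lu_unit]
  refine ⟨fun h => heq_of_tot ?_, fun h => ?_⟩
  · rw [tot_vcomp, tot_vc]; exact h
  · have := tot_of_heq h (by simp) (by simp)
    rwa [tot_vcomp, tot_vc] at this

theorem IsPointwiseLeftKan.exists_ract (hη : IsPointwiseLeftKan η) {k : B ⟶ M}
    (e : Cell d k J (unit M)) : ∃ α : VCell l k, ract η α = e := by
  obtain ⟨α, hα, -⟩ := hη (unit B) k (vc (rightUnitor J) e (Category.id_comp d) (Category.id_comp k))
  exact ⟨α, (ract_eq_iff k α e).2 hα⟩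

theorem IsPointwiseLeftKan.ract_cancel (hη : IsPointwiseLeftKan η) {k : B ⟶ M}
    {α β : VCell l k} (e : ract η α = ract η β) : α = β :=
  (hη (unit B) k (vc (rightUnitor J) (ract η β) (Category.id_comp d) (Category.id_comp k))).unique
    ((ract_eq_iff k α _).1 e) ((ract_eq_iff k β _).1 rfl)

/-- The form in which the lax algebra axioms are verified: two vertical cells whose boundaries agree
only up to propositional equality are compared by their actions on one universal cell. -/
theorem IsPointwiseLeftKan.heq_of_ract (hη : IsPointwiseLeftKan η) {k l' k' : B ⟶ M}
    {α : VCell l k} {β : VCell l' k'} {η' : Cell d l' J (unit M)} (hη' : tot η' = tot η)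
    (e : tot (ract η α) = tot (ract η' β)) : HEq α β := by
  obtain rfl := tot_right hη'
  obtain rfl := tot_right e
  obtain rfl := tot_injective hη'
  exact heq_of_eq (hη.ract_cancel (tot_injective e))

end Kan

/-- The Yoneda lemma for $P$: a vertical cell that acts bijectively on cells out of $y$ is
invertible. Lifting the universal cell of $l'$ through $\alpha$ gives a one-sided inverse $\beta$;
injectivity, tested on the universal cell of $l$, makes it two-sided. -/
theorem IsYonedaEmbedding.isInvertible {y : A ⟶ M} (hy : IsYonedaEmbedding y)
    (h𝕂 : IsEquipment 𝕂) {l l' : B ⟶ M} (α : VCell l l')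
    (ex : ∀ (H : Hor A B) (e' : Cell y l' H (unit M)), ∃ e : Cell y l H (unit M), ract e α = e')
    (un : ∀ (H : Hor A B) (e e' : Cell y l H (unit M)), ract e α = ract e' α → e = e') :
    α.IsInvertible := by
  obtain ⟨J, η, hη⟩ := h𝕂 y (unit M) l
  obtain ⟨J', η', hη'⟩ := h𝕂 y (unit M) l'
  have kη := hy.isPointwiseLeftKan J l η hη
  have kη' := hy.isPointwiseLeftKan J' l' η' hη'
  obtain ⟨e, he⟩ := ex J' η'
  obtain ⟨β, hβ⟩ := kη'.exists_ract e
  have h₁ : β ≫ᵥ α = unitCell l' := by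
    apply kη'.ract_cancel
    rw [ract_comp, hβ, he, ract_unitCell]
  refine ⟨β, ?_, h₁⟩
  apply kη.ract_cancel
  apply un
  rw [ract_comp, ract_unitCell, ← ract_comp (ract η α), h₁, ract_unitCell]

/-- Cells `x` and `x'` correspond under the relative adjunction defined by cells `σ` and `τ` with
the same horizontal source. -/
def AdjRel {f : A ⟶ M} {g : N ⟶ M} {f' : A ⟶ N} {J : Hor A N} (σ : Cell f g J (unit M))
    (τ : Cell f' (𝟙 N) J (unit N)) {H : Hor X Y} (l : X ⟶ A) (k : Y ⟶ N)
    (x : (⟨H⟩ : HorObj 𝕂) ⟶ ⟨unit M⟩) (x' : (⟨H⟩ : HorObj 𝕂) ⟶ ⟨unit N⟩) : Prop :=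
  ∃ ρ : Cell l k H J, tot ρ ≫ tot σ = x ∧ tot ρ ≫ tot τ = x'

namespace AdjRel

variable {f : A ⟶ M} {g : N ⟶ M} {f' : A ⟶ N} {J : Hor A N} {σ : Cell f g J (unit M)}
    {τ : Cell f' (𝟙 N) J (unit N)} {H : Hor X Y} {l : X ⟶ A} {k : Y ⟶ N}
    {x x₁ x₂ : (⟨H⟩ : HorObj 𝕂) ⟶ ⟨unit M⟩} {x' x'₁ x'₂ : (⟨H⟩ : HorObj 𝕂) ⟶ ⟨unit N⟩}

theorem exists_right (hσ : IsCartesian σ) {a : X ⟶ M} {b : Y ⟶ M} {a' : X ⟶ N}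
    (e : Cell a b H (unit M)) (ha : l ≫ f = a) (hb : k ≫ g = b) (ha' : l ≫ f' = a') :
    ∃ e' : Cell a' k H (unit N), AdjRel σ τ l k (tot e) (tot e') := by
  obtain ⟨ρ, hρ⟩ := hσ.exists_vc e ha hb
  exact ⟨vc ρ τ ha' (Category.comp_id k), ρ, hρ, (tot_vc _ _ _ _).symm⟩

theorem exists_left (hτ : IsCartesian τ) {a : X ⟶ M} {b : Y ⟶ M} {a' : X ⟶ N}
    (e' : Cell a' k H (unit N)) (ha : l ≫ f = a) (hb : k ≫ g = b) (ha' : l ≫ f' = a') :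
    ∃ e : Cell a b H (unit M), AdjRel σ τ l k (tot e) (tot e') := by
  obtain ⟨ρ, hρ⟩ := hτ.exists_vc e' ha' (Category.comp_id k)
  exact ⟨vc ρ σ ha hb, ρ, (tot_vc _ _ _ _).symm, hρ⟩

theorem right_unique (hσ : IsCartesian σ) (h₁ : AdjRel σ τ l k x x'₁) (h₂ : AdjRel σ τ l k x x'₂) :
    x'₁ = x'₂ := by
  obtain ⟨ρ₁, e₁, rfl⟩ := h₁
  obtain ⟨ρ₂, e₂, rfl⟩ := h₂
  rw [hσ.cancel (e₁.trans e₂.symm)]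

theorem left_unique (hτ : IsCartesian τ) (h₁ : AdjRel σ τ l k x₁ x') (h₂ : AdjRel σ τ l k x₂ x') :
    x₁ = x₂ := by
  obtain ⟨ρ₁, rfl, e₁⟩ := h₁
  obtain ⟨ρ₂, rfl, e₂⟩ := h₂
  rw [hτ.cancel (e₁.trans e₂.symm)]

theorem precomp (hr : AdjRel σ τ l k x x') {V W : 𝕂} {p : V ⟶ X} {q : W ⟶ Y} {G : Hor V W}
    (θ : Cell p q G H) {l' : V ⟶ A} {k' : W ⟶ N} (hl : p ≫ l = l') (hk : q ≫ k = k') :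
    AdjRel σ τ l' k' (tot θ ≫ x) (tot θ ≫ x') := by
  obtain ⟨ρ, rfl, rfl⟩ := hr
  exact ⟨vc θ ρ hl hk, by simp, by simp⟩

/-- Naturality of the correspondence in the right boundary: acting on the witness $\rho$ with
$\alpha$ induces the action of $g\alpha$ on one side and of $\alpha$ on the other. -/
theorem ract {a : X ⟶ M} {b b' : Y ⟶ M} {e : Cell a b H (unit M)} {a' : X ⟶ N} {k₁ k' : Y ⟶ N}
    {e' : Cell a' k₁ H (unit N)} (hr : AdjRel σ τ l k (tot e) (tot e')) {β : VCell b b'}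
    {α : VCell k₁ k'} (hβ : tot β = tot α ≫ tot (unitCell g)) :
    AdjRel σ τ l k' (tot (DoubleCategory.ract e β)) (tot (DoubleCategory.ract e' α)) := by
  obtain ⟨ρ, h₁, h₂⟩ := hr
  have hk : k = k₁ := by
    rw [← tot_vcomp] at h₂
    rw [← tot_right h₂, Category.comp_id]
  subst hk
  have hk' : k' ≫ g = b' := by
    rw [← tot_vcomp] at hβ
    exact (tot_right hβ).symm
  refine ⟨DoubleCategory.ract ρ α, ?_, ?_⟩
  · rw [← tot_vc _ _ rfl hk', ← ract_vc ρ σ α rfl rfl rfl hk']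
    exact tot_ract_congr (by rw [tot_vc, h₁]) (by rw [tot_vc, hβ])
  · rw [← tot_vc _ _ rfl (Category.comp_id k'), ← ract_vc ρ τ α rfl (Category.comp_id k)
      (Category.comp_id k) (Category.comp_id k')]
    exact tot_ract_congr (by rw [tot_vc, h₂]) (by rw [tot_vc, tot_unitCell_id, Category.comp_id])

end AdjRel

end

end DoubleCategory

/-! ### The monad on cells into units -/

namespace NormalLaxDoubleMonad

variable {𝕂 : Type u} [DoubleCategory.{c, h, v} 𝕂] (T : NormalLaxDoubleMonad 𝕂) {A B C D M N X Y : 𝕂}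

theorem tot_recast_hor {a : A ⟶ C} {b : B ⟶ D} {J J' : Hor A B} {K K' : Hor C D} (hJ : J = J')
    (hK : K = K') (φ : Cell a b J K) {u : Cell (𝟙 A) (𝟙 B) J' J} (hu : HEq u (vid J')) :
    tot (recast rfl rfl hJ hK φ) = tot u ≫ tot φ ≫ tot (recast rfl rfl hK.symm rfl (vid K') :
      Cell (𝟙 C) (𝟙 D) K K') := by
  subst hJ hK
  rw [eq_of_heq hu]
  exact ((Category.id_comp _).trans (Category.comp_id (tot φ))).symm

/-- `T` on cells into a unit, with the identification `T 1 = 1`. -/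
def elTot {J : Hor A B} (x : (⟨J⟩ : HorObj 𝕂) ⟶ ⟨unit M⟩) :
    (⟨T.mapHor J⟩ : HorObj 𝕂) ⟶ ⟨unit (T.obj M)⟩ :=
  T.mapTot x ≫ (T.isNormal.unitorIso M).inv

/-- `T` on cells into a unit, with the identification `T 1 = 1` and with prescribed boundary. -/
def el {J : Hor A B} {a : A ⟶ M} {b : B ⟶ M} (e : Cell a b J (unit M)) {a' : T.obj A ⟶ T.obj M}
    {b' : T.obj B ⟶ T.obj M} (ha : T.map a = a') (hb : T.map b = b') :
    Cell a' b' (T.mapHor J) (unit (T.obj M)) :=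
  vc (T.mapCell e) (T.isNormal.unitorInv M) ((Category.comp_id _).trans ha)
    ((Category.comp_id _).trans hb)

section

variable {J : Hor A B} {a : A ⟶ M} {b : B ⟶ M} (e : Cell a b J (unit M)) {a' : T.obj A ⟶ T.obj M}
    {b' : T.obj B ⟶ T.obj M} (ha : T.map a = a') (hb : T.map b = b')

theorem tot_el : tot (T.el e ha hb) = T.elTot (tot e) := tot_vc _ _ _ _

theorem isCartesian_el (h𝕂 : IsEquipment 𝕂) {e : Cell a b J (unit M)} (he : IsCartesian e) :
    IsCartesian (T.el e ha hb) :=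
  (LaxDoubleFunctor.isCartesian_mapCell (T := T.toLaxDoubleFunctor) h𝕂 he).of_tot_comp
    (isCartesian_of_inverse (T.isNormal.unitorIso M).inv_hom_id
      (T.isNormal.unitorIso M).hom_inv_id) ((Category.comp_id _).trans ha) ((Category.comp_id _).trans hb)
    (tot_vc _ _ _ _)

end

theorem elTot_comp {J : Hor A B} {H : Hor C D} {a : C ⟶ A} {b : D ⟶ B} (θ : Cell a b H J)
    (x : (⟨J⟩ : HorObj 𝕂) ⟶ ⟨unit M⟩) :
    T.elTot (tot θ ≫ x) = tot (T.mapCell θ) ≫ T.elTot x := by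
  rw [elTot, elTot, LaxDoubleFunctor.mapTot_comp, Category.assoc]
  rfl

theorem tot_mapV {f g : A ⟶ C} (φ : VCell f g) :
    tot (T.mapV φ) = (T.isNormal.unitorIso A).hom ≫ T.elTot (tot φ) :=
  tot_recast_hor _ _ (T.mapCell φ) (T.isNormal.unitor_eq A)

theorem elTot_comp_vcell {J : Hor A B} (x : (⟨J⟩ : HorObj 𝕂) ⟶ ⟨unit M⟩) {f g : M ⟶ N}
    (ξ : VCell f g) : T.elTot (x ≫ tot ξ) = T.elTot x ≫ tot (T.mapV ξ) := by
  rw [tot_mapV, elTot, elTot, LaxDoubleFunctor.mapTot_comp, elTot, Category.assoc, Category.assoc,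
    Iso.inv_hom_id_assoc]

theorem mapV_unitCell (f : A ⟶ C) : T.mapV (unitCell f) = unitCell (T.map f) := by
  apply tot_injective
  rw [tot_mapV, elTot, ← Category.assoc, Iso.comp_inv_eq]
  exact (T.tot_unitor_naturality f).symm

theorem elTot_comp_unitCell {J : Hor A B} (x : (⟨J⟩ : HorObj 𝕂) ⟶ ⟨unit M⟩) (f : M ⟶ N) :
    T.elTot (x ≫ tot (unitCell f)) = T.elTot x ≫ tot (unitCell (T.map f)) := by
  rw [elTot_comp_vcell, mapV_unitCell]

theorem comp_iota {J : Hor A B} {a : A ⟶ M} {b : B ⟶ M} (e : Cell a b J (unit M)) :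
    tot e ≫ tot (unitCell (T.iota M)) = tot (T.iotaCell J) ≫ T.elTot (tot e) := by
  have h₁ : tot (vcomp e (T.iotaCell (unit M))) = tot (vcomp (T.iotaCell J) (T.mapCell e)) :=
    tot_of_heq (T.iotaCell_naturality e) (T.iota_naturality a) (T.iota_naturality b)
  have h₂ : tot (vcomp (unitCell (T.iota M)) (T.unitor M)) = tot (T.iotaCell (unit M)) :=
    tot_of_heq (T.iotaCell_unit M) (Category.comp_id _) (Category.comp_id _)
  rw [elTot, ← Category.assoc, Iso.eq_comp_inv, Category.assoc]
  rw [tot_vcomp] at h₁ h₂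
  exact (congrArg (fun t => tot e ≫ t) h₂).trans h₁

/-- Naturality of $\mu$ on cells combined with its unit axiom: under $T1 = 1$, the component of
$\mu$ at a horizontal unit is the unit cell of a component of $\mu$. -/
theorem comp_mu {J : Hor A B} {a : A ⟶ M} {b : B ⟶ M} (e : Cell a b J (unit M)) :
    T.elTot (T.elTot (tot e)) ≫ tot (unitCell (T.mu M)) =
      tot (T.muCell J) ≫ T.elTot (tot e) := by
  have h₁ : tot (vcomp (T.mapCell (T.mapCell e)) (T.muCell (unit M))) =
      tot (vcomp (T.muCell J) (T.mapCell e)) :=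
    tot_of_heq (T.muCell_naturality e) (T.mu_naturality a) (T.mu_naturality b)
  have h₂ : tot (vcomp (unitCell (T.mu M)) (T.unitor M)) =
      tot (vcomp (vcomp (T.unitor (T.obj M)) (T.mapCell (T.unitor M))) (T.muCell (unit M))) :=
    tot_of_heq (T.muCell_unit M) (by simp) (by simp)
  have h₃ : T.mapTot (T.isNormal.unitorIso M).inv ≫ T.mapTot (T.isNormal.unitorIso M).hom = 𝟙 _ := by
    rw [← LaxDoubleFunctor.mapTot_comp, Iso.inv_hom_id, LaxDoubleFunctor.mapTot_id]
  rw [tot_vcomp, tot_vcomp, tot_vcomp] at h₂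
  rw [tot_vcomp, tot_vcomp] at h₁
  have h₂' : tot (unitCell (T.mu M)) = (T.isNormal.unitorIso (T.obj M)).hom ≫
      T.mapTot (T.isNormal.unitorIso M).hom ≫ tot (T.muCell (unit M)) ≫
        (T.isNormal.unitorIso M).inv := by
    rw [← Category.assoc, ← Category.assoc, Iso.eq_comp_inv, Category.assoc]
    exact h₂.trans (Category.assoc _ _ _)
  rw [elTot, elTot, LaxDoubleFunctor.mapTot_comp, h₂']
  simp only [Category.assoc]
  rw [Iso.inv_hom_id_assoc, reassoc_of% h₃, ← Category.assoc, ← Category.assoc]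
  exact congrArg (fun t => t ≫ (T.isNormal.unitorIso M).inv) h₁

/-- The right action is a horizontal composite with a unit cell, so $T$ preserves it by naturality
of the compositor and the right unit axiom; normality identifies the result as an action again. -/
theorem elTot_ract {H : Hor A B} {a : A ⟶ M} {b b' : B ⟶ M} (e : Cell a b H (unit M))
    (α : VCell b b') {a₁ : T.obj A ⟶ T.obj M} (ha : T.map a = a₁) :
    T.elTot (tot (ract e α)) = tot (ract (T.el e ha rfl) (T.mapV α)) := by
  have h₁ : tot (hcomp (T.el e ha rfl) (T.mapV α)) =
      tot (hcomp (vid (T.mapHor H)) (T.unitor B)) ≫ tot (hcomp (T.mapCell e) (T.mapCell α)) ≫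
        tot (hcomp (T.isNormal.unitorInv M) (T.isNormal.unitorInv M)) :=
    tot_hcomp_comp₃ (by rw [tot_el]; simp [elTot]; rfl) (by rw [tot_mapV]; rfl)
  have h₂ : tot (hcomp (T.isNormal.unitorInv M) (T.isNormal.unitorInv M)) =
      tot (hcomp (vid (T.mapHor (unit M))) (T.isNormal.unitorInv M)) ≫
        tot (hcomp (T.isNormal.unitorInv M) (unitCell (𝟙 _))) :=
    tot_hcomp_comp (by simp) (by simp [tot_unitCell_id])
  have h₃ : tot (hcomp (vid (T.mapHor (unit M))) (T.isNormal.unitorInv M)) ≫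
      tot (hcomp (vid (T.mapHor (unit M))) (T.unitor M)) = 𝟙 _ := by
    rw [← tot_hcomp_comp (φ := vid _) (ψ := vid _), tot_hcomp_vid]
    · simp
    · exact (T.isNormal.unitorIso M).inv_hom_id.symm
  rw [tot_ract, tot_ract, h₁, h₂]
  simp only [Category.assoc]
  rw [ru_naturality, ← LaxDoubleFunctor.tot_compositor_rightUnitor]
  simp only [Category.assoc]
  rw [reassoc_of% h₃, reassoc_of% LaxDoubleFunctor.tot_compositor_naturality,
    reassoc_of% LaxDoubleFunctor.ru_inv_compositor, elTot, LaxDoubleFunctor.mapTot_comp,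
    LaxDoubleFunctor.mapTot_comp]
  simp only [Category.assoc]
  rfl

/-- The image of a witness is a witness. Having the correspondence as a relation, witnessed by a
common factorisation, makes this immediate, with no cartesianness needed. -/
theorem adjRel_elTot {f : A ⟶ M} {g : N ⟶ M} {f' : A ⟶ N} {J : Hor A N} {σ : Cell f g J (unit M)}
    {τ : Cell f' (𝟙 N) J (unit N)} {H : Hor X Y} {l : X ⟶ A} {k : Y ⟶ N}
    {x : (⟨H⟩ : HorObj 𝕂) ⟶ ⟨unit M⟩} {x' : (⟨H⟩ : HorObj 𝕂) ⟶ ⟨unit N⟩}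
    (hr : AdjRel σ τ l k x x') {f₁ : T.obj A ⟶ T.obj M} {g₁ : T.obj N ⟶ T.obj M}
    {f'₁ : T.obj A ⟶ T.obj N} (hf : T.map f = f₁) (hg : T.map g = g₁) (hf' : T.map f' = f'₁)
    {l₁ : T.obj X ⟶ T.obj A} {k₁ : T.obj Y ⟶ T.obj N} (hl : T.map l = l₁) (hk : T.map k = k₁) :
    AdjRel (T.el σ hf hg) (T.el τ hf' (T.map_id N)) l₁ k₁ (T.elTot x) (T.elTot x') := by
  obtain ⟨ρ, rfl, rfl⟩ := hr
  subst hl hk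
  exact ⟨T.mapCell ρ, by rw [tot_el, elTot_comp], by rw [tot_el, elTot_comp]⟩

end NormalLaxDoubleMonad

/-! ### The relative adjunction, and construction of the unitor and the associator -/

namespace NormalLaxDoubleMonad

variable {𝕂 : Type u} [DoubleCategory.{c, h, v} 𝕂] (T : NormalLaxDoubleMonad 𝕂)

/-- A yoneda embedding `y : A ⟶ P` and a morphism `w : T P ⟶ P`, together with a horizontal morphism
`J` that is both the restriction `1_P(y, w)` and the companion of `y ≫ ι`. -/
structure RelativeAdjunction {A P : 𝕂} (y : A ⟶ P) (w : T.obj P ⟶ P) where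
  isEquipment : IsEquipment 𝕂
  yoneda : IsYonedaEmbedding y
  J : Hor A (T.obj P)
  σ : Cell y w J (unit P)
  τ : Cell (y ≫ T.iota P) (𝟙 (T.obj P)) J (unit (T.obj P))
  cartesian_σ : IsCartesian σ
  cartesian_τ : IsCartesian τ
  Y : Hor A P
  ε : Cell y (𝟙 P) Y (unit P)
  cartesian_ε : IsCartesian ε

variable {T}

namespace RelativeAdjunction

variable {A P : 𝕂} {y : A ⟶ P} {w : T.obj P ⟶ P} (S : T.RelativeAdjunction y w)

/-- `T σ` -/
def Tσ : Cell (T.map y) (T.map w) (T.mapHor S.J) (unit (T.obj P)) := T.el S.σ rfl rfl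

/-- `T τ` -/
def Tτ : Cell (T.map (y ≫ T.iota P)) (𝟙 (T.obj (T.obj P))) (T.mapHor S.J)
    (unit (T.obj (T.obj P))) := T.el S.τ rfl (T.map_id _)

/-- `T (T σ)` -/
def TTσ : Cell (T.map (T.map y)) (T.map (T.map w)) (T.mapHor (T.mapHor S.J))
    (unit (T.obj (T.obj P))) := T.el S.Tσ rfl rfl

/-- `T (T τ)` -/
def TTτ : Cell (T.map (T.map (y ≫ T.iota P))) (𝟙 (T.obj (T.obj (T.obj P))))
    (T.mapHor (T.mapHor S.J)) (unit (T.obj (T.obj (T.obj P)))) := T.el S.Tτ rfl (T.map_id _)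

theorem cartesian_Tσ : IsCartesian S.Tσ := T.isCartesian_el _ _ S.isEquipment S.cartesian_σ
theorem cartesian_Tτ : IsCartesian S.Tτ := T.isCartesian_el _ _ S.isEquipment S.cartesian_τ
theorem cartesian_TTσ : IsCartesian S.TTσ := T.isCartesian_el _ _ S.isEquipment S.cartesian_Tσ

/-- The correspondence between cells into `1_P` and cells into `1_{T P}`. -/
abbrev Rel {X Y : 𝕂} {H : Hor X Y} (l : X ⟶ A) (k : Y ⟶ T.obj P)
    (x : (⟨H⟩ : HorObj 𝕂) ⟶ ⟨unit P⟩) (x' : (⟨H⟩ : HorObj 𝕂) ⟶ ⟨unit (T.obj P)⟩) : Prop :=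
  AdjRel S.σ S.τ l k x x'

/-- The image under `T` of the correspondence `Rel`. -/
abbrev TRel {X Y : 𝕂} {H : Hor X Y} (l : X ⟶ T.obj A) (k : Y ⟶ T.obj (T.obj P))
    (x : (⟨H⟩ : HorObj 𝕂) ⟶ ⟨unit (T.obj P)⟩)
    (x' : (⟨H⟩ : HorObj 𝕂) ⟶ ⟨unit (T.obj (T.obj P))⟩) : Prop :=
  AdjRel S.Tσ S.Tτ l k x x'

/-- The image under `T` of the correspondence `TRel`. -/
abbrev TTRel {X Y : 𝕂} {H : Hor X Y} (l : X ⟶ T.obj (T.obj A)) (k : Y ⟶ T.obj (T.obj (T.obj P)))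
    (x : (⟨H⟩ : HorObj 𝕂) ⟶ ⟨unit (T.obj (T.obj P))⟩)
    (x' : (⟨H⟩ : HorObj 𝕂) ⟶ ⟨unit (T.obj (T.obj (T.obj P)))⟩) : Prop :=
  AdjRel S.TTσ S.TTτ l k x x'

theorem rel_σ_τ : S.Rel (𝟙 A) (𝟙 _) (tot S.σ) (tot S.τ) :=
  ⟨vid S.J, Category.id_comp _, Category.id_comp _⟩

theorem Rel.elTot {S : T.RelativeAdjunction y w} {X Y : 𝕂} {H : Hor X Y} {l : X ⟶ A}
    {k : Y ⟶ T.obj P} {x : (⟨H⟩ : HorObj 𝕂) ⟶ ⟨unit P⟩}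
    {x' : (⟨H⟩ : HorObj 𝕂) ⟶ ⟨unit (T.obj P)⟩} (hr : S.Rel l k x x') :
    S.TRel (T.map l) (T.map k) (T.elTot x) (T.elTot x') :=
  T.adjRel_elTot hr _ _ _ rfl rfl

theorem TRel.elTot {S : T.RelativeAdjunction y w} {X Y : 𝕂} {H : Hor X Y} {l : X ⟶ T.obj A}
    {k : Y ⟶ T.obj (T.obj P)} {x : (⟨H⟩ : HorObj 𝕂) ⟶ ⟨unit (T.obj P)⟩}
    {x' : (⟨H⟩ : HorObj 𝕂) ⟶ ⟨unit (T.obj (T.obj P))⟩} (hr : S.TRel l k x x') :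
    S.TTRel (T.map l) (T.map k) (T.elTot x) (T.elTot x') :=
  T.adjRel_elTot hr _ _ _ rfl rfl

theorem kan (S : T.RelativeAdjunction y w) {B : 𝕂} {l : B ⟶ P} {K : Hor A B}
    {κ : Cell y l K (unit P)} (hκ : IsCartesian κ) :
    IsPointwiseLeftKan κ := S.yoneda.isPointwiseLeftKan K l κ hκ

/-- The defining property of the unitor of the lax algebra. -/
def IsUnitor (what : VCell (𝟙 P) (T.iota P ≫ w)) : Prop :=
  S.Rel (𝟙 A) (T.iota P) (tot S.ε ≫ tot what) (tot S.ε ≫ tot (unitCell (T.iota P)))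

/-- Since $\varepsilon$ is cartesian, $\mathrm{id}_P$ is the left Kan extension of $y$ along $y_*$,
so the transpose of $\iota\varepsilon$ is $\varepsilon$ followed by a vertical cell. -/
theorem exists_isUnitor : ∃ what, S.IsUnitor what := by
  obtain ⟨e, he⟩ := AdjRel.exists_left S.cartesian_τ
    (vc S.ε (unitCell (T.iota P)) rfl (Category.id_comp _)) (Category.id_comp y)
    (rfl : T.iota P ≫ w = _) (Category.id_comp (y ≫ T.iota P))
  obtain ⟨what, hw⟩ := (S.kan S.cartesian_ε).exists_ract e
  refine ⟨what, ?_⟩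
  rw [← hw, tot_ract_of_id rfl, tot_vc] at he
  exact he

namespace IsUnitor

variable {S} {what : VCell (𝟙 P) (T.iota P ≫ w)}

theorem rel (hw : S.IsUnitor what) {B : 𝕂} {H : Hor A B} {k : B ⟶ P} (e : Cell y k H (unit P))
    {k' : B ⟶ T.obj P}
    (hk : k ≫ T.iota P = k') :
    S.Rel (𝟙 A) k' (tot e ≫ tot what) (tot e ≫ tot (unitCell (T.iota P))) := by
  obtain ⟨ρ, hρ⟩ := S.cartesian_ε.exists_vc e (Category.id_comp y) (Category.comp_id k)
  rw [← hρ, Category.assoc, Category.assoc]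
  exact AdjRel.precomp hw ρ (Category.id_comp _) hk

/-- The defining property of the unitor lives over $\varepsilon$; its image lives over
$T\varepsilon$, which is again cartesian, so every cell whose left boundary factors through $Ty$
inherits it by precomposition. -/
theorem tRel (hw : S.IsUnitor what) {X Y : 𝕂} {H : Hor X Y} {l : X ⟶ T.obj A} {a : X ⟶ T.obj P}
    {k : Y ⟶ T.obj P}
    (e : Cell a k H (unit (T.obj P))) (ha : l ≫ T.map y = a) {k' : Y ⟶ T.obj (T.obj P)}
    (hk : k ≫ T.map (T.iota P) = k') :
    S.TRel l k' (tot e ≫ tot (T.mapV what)) (tot e ≫ tot (unitCell (T.map (T.iota P)))) := by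
  have hTε : IsCartesian (T.el S.ε rfl (T.map_id P)) :=
    T.isCartesian_el _ _ S.isEquipment S.cartesian_ε
  obtain ⟨ρ, hρ⟩ := hTε.exists_vc e ha (Category.comp_id k)
  have h₁ := Rel.elTot hw
  rw [elTot_comp_vcell, elTot_comp_unitCell, ← T.tot_el S.ε rfl (T.map_id P)] at h₁
  rw [← hρ, Category.assoc, Category.assoc]
  exact AdjRel.precomp h₁ ρ (by rw [T.map_id, Category.comp_id]) hk

end IsUnitor

/-- The defining property of the associator of the lax algebra. -/
def IsAssociator (wbar : VCell (T.map w ≫ w) (T.mu P ≫ w)) : Prop :=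
  ∀ ⦃B : 𝕂⦄ ⦃H : Hor A B⦄ ⦃k : B ⟶ T.obj (T.obj P)⦄ ⦃b b' : B ⟶ P⦄ (e : Cell y b H (unit P))
    (x₁ : (⟨H⟩ : HorObj 𝕂) ⟶ ⟨unit (T.obj P)⟩) (x₂ : (⟨H⟩ : HorObj 𝕂) ⟶ ⟨unit (T.obj (T.obj P))⟩)
    (α : VCell b b'), tot α = tot (unitCell k) ≫ tot wbar →
    S.Rel (𝟙 A) (k ≫ T.map w) (tot e) x₁ → S.TRel (T.iota A) k x₁ x₂ →
    S.Rel (𝟙 A) (k ≫ T.mu P) (tot (ract e α)) (x₂ ≫ tot (unitCell (T.mu P)))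

theorem iota_naturality_y : T.iota A ≫ T.map y = y ≫ T.iota P := (T.iota_naturality y).symm

theorem iota_map_y_iota : T.iota A ≫ T.map (y ≫ T.iota P) = y ≫ T.iota P ≫ T.map (T.iota P) := by
  rw [T.map_comp, ← Category.assoc, ← T.iota_naturality, Category.assoc]

/-- The chain of cells that correspond to a cell into `1_P` with right boundary `k ≫ T w ≫ w`. -/
theorem exists_chain {B : 𝕂} {H : Hor A B} {k : B ⟶ T.obj (T.obj P)} {b : B ⟶ P}
    (e : Cell y b H (unit P)) (hb : k ≫ T.map w ≫ w = b) :
    ∃ (e₁ : Cell (y ≫ T.iota P) (k ≫ T.map w) H (unit (T.obj P)))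
      (e₂ : Cell (y ≫ T.iota P ≫ T.map (T.iota P)) k H (unit (T.obj (T.obj P)))),
      S.Rel (𝟙 A) (k ≫ T.map w) (tot e) (tot e₁) ∧ S.TRel (T.iota A) k (tot e₁) (tot e₂) := by
  obtain ⟨e₁, h₁⟩ := AdjRel.exists_right S.cartesian_σ e (Category.id_comp y)
    ((Category.assoc k _ _).trans hb) (Category.id_comp (y ≫ T.iota P))
  obtain ⟨e₂, h₂⟩ := AdjRel.exists_right S.cartesian_Tσ e₁ iota_naturality_y rfl iota_map_y_iota
  exact ⟨e₁, e₂, h₁, h₂⟩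

/-- It suffices to treat $k = \mathrm{id}$ and the cartesian cell $\kappa$ into $w\,Tw$, whose Kan
property turns the transpose of $\mu\kappa_2$ into a vertical cell. Any other $e$ is a precomposite
of $\kappa$, and uniqueness of transposes identifies its chain with that of $\kappa$, precomposed.
-/
theorem exists_isAssociator : ∃ wbar, S.IsAssociator wbar := by
  obtain ⟨K, κ, hκ⟩ := S.isEquipment y (unit P) (T.map w ≫ w)
  obtain ⟨κ₁, κ₂, h₁, h₂⟩ := S.exists_chain κ (Category.id_comp (T.map w ≫ w))
  obtain ⟨e, he⟩ := AdjRel.exists_left S.cartesian_τ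
    (vc κ₂ (unitCell (T.mu P)) (show _ = y ≫ T.iota P by
      rw [Category.assoc, Category.assoc, T.map_iota_mu, Category.comp_id]) (Category.id_comp _))
    (Category.id_comp y) (rfl : T.mu P ≫ w = _) (Category.id_comp (y ≫ T.iota P))
  obtain ⟨wbar, hw⟩ := (S.kan hκ).exists_ract e
  refine ⟨wbar, fun B H k b b' e' x₁ x₂ α hα hx₁ hx₂ => ?_⟩
  have hb : k ≫ T.map w ≫ w = b := by
    rw [← tot_vcomp] at hα
    exact (tot_left hα).symm
  obtain ⟨ρ, hρ⟩ := hκ.exists_vc e' (Category.id_comp y) hb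
  rw [← hρ] at hx₁
  obtain rfl := AdjRel.right_unique S.cartesian_σ hx₁
    (AdjRel.precomp h₁ ρ (Category.id_comp _) (by rw [Category.id_comp]))
  obtain rfl := AdjRel.right_unique S.cartesian_Tσ hx₂
    (AdjRel.precomp h₂ ρ (Category.id_comp _) (Category.comp_id k))
  rw [tot_ract_of_comp hρ.symm hα, hw, Category.assoc]
  rw [tot_vc] at he
  exact AdjRel.precomp he ρ (Category.id_comp _) rfl

/-- Apply $T$ to the universal instance of the defining property, the one over $\kappa$, and
transport along a factorisation through the cartesian $T\kappa$. Needed for the associativity axiom,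
where $T\bar w$ occurs. -/
theorem IsAssociator.tRel {S : T.RelativeAdjunction y w} {wbar : VCell (T.map w ≫ w) (T.mu P ≫ w)}
    (hw : S.IsAssociator wbar) {X Y : 𝕂} {H : Hor X Y} {l : X ⟶ T.obj A}
    {k : Y ⟶ T.obj (T.obj (T.obj P))} {a : X ⟶ T.obj P} {b b' : Y ⟶ T.obj P}
    (e : Cell a b H (unit (T.obj P))) (ha : l ≫ T.map y = a)
    {x₁ : (⟨H⟩ : HorObj 𝕂) ⟶ ⟨unit (T.obj (T.obj P))⟩}
    {x₂ : (⟨H⟩ : HorObj 𝕂) ⟶ ⟨unit (T.obj (T.obj (T.obj P)))⟩}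
    {α : VCell b b'} (hα : tot α = tot (unitCell k) ≫ tot (T.mapV wbar))
    (hx₁ : S.TRel l (k ≫ T.map (T.map w)) (tot e) x₁)
    (hx₂ : S.TTRel (l ≫ T.map (T.iota A)) k x₁ x₂) :
    S.TRel l (k ≫ T.map (T.mu P)) (tot (ract e α)) (x₂ ≫ tot (unitCell (T.map (T.mu P)))) := by
  obtain ⟨K, κ, hκ⟩ := S.isEquipment y (unit P) (T.map w ≫ w)
  obtain ⟨κ₁, κ₂, h₁, h₂⟩ := S.exists_chain κ (Category.id_comp (T.map w ≫ w))
  have h₃ := hw κ (tot κ₁) (tot κ₂) wbar (by rw [tot_unitCell_id, Category.id_comp]) h₁ h₂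
  have hb : k ≫ T.map (T.map w ≫ w) = b := by
    rw [← tot_vcomp] at hα
    exact (tot_left hα).symm
  have hTκ : IsCartesian (T.el κ rfl rfl) := T.isCartesian_el _ _ S.isEquipment hκ
  obtain ⟨ρ, hρ⟩ := hTκ.exists_vc e ha hb
  have h₁' := Rel.elTot h₁
  have h₂' := TRel.elTot h₂
  have h₃' := Rel.elTot h₃
  rw [← T.tot_el κ rfl rfl] at h₁'
  rw [T.elTot_ract κ wbar rfl, T.elTot_comp_unitCell] at h₃'
  rw [← hρ] at hx₁
  obtain rfl := AdjRel.right_unique S.cartesian_Tσ hx₁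
    (AdjRel.precomp h₁' ρ (by rw [T.map_id, Category.comp_id]) (by rw [Category.id_comp]))
  obtain rfl := AdjRel.right_unique S.cartesian_TTσ hx₂
    (AdjRel.precomp h₂' ρ rfl (by rw [T.map_id, Category.comp_id]))
  rw [tot_ract_of_comp hρ.symm hα, Category.assoc]
  exact AdjRel.precomp h₃' ρ (by rw [T.map_id, Category.comp_id]) (by rw [Category.id_comp])

end RelativeAdjunction

end NormalLaxDoubleMonad

/-! ### Absorption of vertical cells that restrict to identities -/

namespace DoubleCategory

variable {𝕂 : Type u} [DoubleCategory.{c, h, v} 𝕂] {A B C D E F M N X Y : 𝕂}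

theorem IsCartesian.cst {a a' : A ⟶ C} {b b' : B ⟶ D} {H : Hor A B} {K : Hor C D} {φ : Cell a b H K}
    (hφ : IsCartesian φ) (ha : a = a') (hb : b = b') : IsCartesian (cst φ ha hb) := by
  subst ha hb
  exact hφ

theorem tot_ract_comp_right {a : A ⟶ C} {b b' : B ⟶ D} {H : Hor A B} {K : Hor C D} {f : C ⟶ E}
    {g : D ⟶ F} {L : Hor E F} {e : Cell a b H K} {σ : Cell f g K L} {α : VCell b b'}
    {a₁ : A ⟶ E} {b₁ b₁' : B ⟶ F} {e₁ : Cell a₁ b₁ H L} {α₁ : VCell b₁ b₁'}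
    (he : tot e₁ = tot e ≫ tot σ) (hα : tot α₁ = tot α ≫ tot (unitCell g)) :
    tot (ract e₁ α₁) = tot (ract e α) ≫ tot σ := by
  rw [← tot_vc (ract e α) σ rfl rfl, ← ract_vc e σ α rfl rfl rfl rfl]
  exact tot_ract_congr (by rw [tot_vc, he]) (by rw [tot_vc, hα])

theorem tot_ract_of_unitCell {a : A ⟶ C} {b b' g : B ⟶ D} {H : Hor A B} {K : Hor C D}
    (e : Cell a b H K) {α : VCell b b'} (hα : tot α = tot (unitCell g)) :
    tot (ract e α) = tot e := by
  obtain rfl := tot_left hα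
  obtain rfl := tot_right hα
  rw [tot_injective hα, ract_unitCell]

theorem tot_lact_of_unitCell {a a' g : A ⟶ C} {b : B ⟶ D} {H : Hor A B} {K : Hor C D}
    (e : Cell a' b H K) {α : VCell a a'} (hα : tot α = tot (unitCell g)) :
    tot (lact α e) = tot e := by
  obtain rfl := tot_left hα
  obtain rfl := tot_right hα
  rw [tot_injective hα, lact_unitCell]

theorem tot_ract_unitCell_left {f g k j : A ⟶ C} {φ : VCell f g} (hφ : tot φ = tot (unitCell j))
    (ψ : VCell g k) : tot (ract φ ψ) = tot ψ := by
  rw [← VCell.comp_eq_ract, VCell.comp_eq_lact, tot_lact_of_unitCell ψ hφ]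

/-- A vertical cell that restricts to an identity along the left boundary of `e` is absorbed. -/
theorem comp_vcell_eq {m : A ⟶ M} {n : B ⟶ M} {H : Hor A B} (e : Cell m n H (unit M)) {f g : M ⟶ N}
    {ξ : VCell f g} {j : A ⟶ N} (hξ : tot (unitCell m) ≫ tot ξ = tot (unitCell j)) :
    tot e ≫ tot ξ = tot e ≫ tot (unitCell g) := by
  rw [← tot_vc e ξ rfl rfl, ← vc_eq_lact e ξ rfl rfl rfl, tot_lact_of_unitCell, tot_vc]
  rw [tot_vc, hξ]

theorem AdjRel.congr {f : A ⟶ M} {g : N ⟶ M} {f' : A ⟶ N} {J : Hor A N} {σ : Cell f g J (unit M)}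
    {τ : Cell f' (𝟙 N) J (unit N)} {H : Hor X Y} {l : X ⟶ A} {k k₁ : Y ⟶ N}
    {x x₁ : (⟨H⟩ : HorObj 𝕂) ⟶ ⟨unit M⟩} {x' x'₁ : (⟨H⟩ : HorObj 𝕂) ⟶ ⟨unit N⟩}
    (hr : AdjRel σ τ l k x x') (hk : k = k₁) (hx : x = x₁) (hx' : x' = x'₁) :
    AdjRel σ τ l k₁ x₁ x'₁ := by
  subst hk hx hx'
  exact hr

end DoubleCategory

/-! ### Colax-idempotence: the adjunction between units and multiplications -/

namespace NormalLaxDoubleMonad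

variable {𝕂 : Type u} [DoubleCategory.{c, h, v} 𝕂] (T : NormalLaxDoubleMonad 𝕂) {A C : 𝕂}

theorem iota_mapV {f g : A ⟶ C} (φ : VCell f g) :
    tot (unitCell (T.iota A)) ≫ tot (T.mapV φ) = tot φ ≫ tot (unitCell (T.iota C)) := by
  have h₂ : tot (vcomp (unitCell (T.iota A)) (T.unitor A)) = tot (T.iotaCell (unit A)) :=
    tot_of_heq (T.iotaCell_unit A) (Category.comp_id _) (Category.comp_id _)
  rw [tot_mapV, comp_iota, ← h₂, tot_vcomp, Category.assoc]
  rfl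

/-- The free algebra on `A`. -/
abbrev freeAlgebra (A : 𝕂) : T.StrictAlgebra (T.obj A) where
  act := T.mu A
  assoc := (T.mu_assoc A).symm
  unit := T.iota_mu A

variable {T}

theorem isColaxMorphism_iff {a : T.StrictAlgebra A} {c : T.StrictAlgebra C} {f : A ⟶ C}
    {fbar : VCell (a.act ≫ f) (T.map f ≫ c.act)} :
    IsColaxMorphism a c f fbar ↔
      tot (unitCell (T.iota A)) ≫ tot fbar = tot (unitCell f) ∧
      tot (unitCell (T.mu A)) ≫ tot fbar =
        tot (ract (vc (unitCell (T.map a.act)) fbar rfl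
            (show _ = T.map (a.act ≫ f) ≫ c.act by rw [T.map_comp, Category.assoc]))
          (VCell.whiskerRight (T.mapV fbar) c.act)) := by
  have hr : tot (VCell.whiskerLeft (T.map a.act) fbar ≫ᵥ
      VCell.ofEq (show T.map a.act ≫ T.map f ≫ c.act = T.map (a.act ≫ f) ≫ c.act by
        rw [T.map_comp, Category.assoc]) ≫ᵥ VCell.whiskerRight (T.mapV fbar) c.act) =
        tot (ract (vc (unitCell (T.map a.act)) fbar rfl
            (show _ = T.map (a.act ≫ f) ≫ c.act by rw [T.map_comp, Category.assoc]))
          (VCell.whiskerRight (T.mapV fbar) c.act)) := by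
    rw [VCell.comp_eq_ract, ract_comp, ract_ofEq]
    exact tot_ract_congr (by rw [tot_cst, tot_vc]; rfl) rfl
  have h₁ : T.iota A ≫ a.act ≫ f = f := by rw [← Category.assoc, a.unit, Category.id_comp]
  have h₂ : T.iota A ≫ T.map f ≫ c.act = f := by
    rw [← Category.assoc, ← T.iota_naturality, Category.assoc, c.unit, Category.comp_id]
  have h₃ : T.mu A ≫ a.act ≫ f = T.map a.act ≫ a.act ≫ f := by
    rw [← Category.assoc, ← a.assoc, Category.assoc]
  have h₄ : T.mu A ≫ T.map f ≫ c.act = T.map (T.map f ≫ c.act) ≫ c.act := by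
    rw [← Category.assoc, ← T.mu_naturality, Category.assoc, ← c.assoc, T.map_comp, Category.assoc]
  rw [← hr]
  exact ⟨fun hf => ⟨tot_of_heq hf.unit h₁ h₂, tot_of_heq hf.assoc h₃ h₄⟩,
    fun hf => ⟨heq_of_tot hf.1, heq_of_tot hf.2⟩⟩

/-- For a colax-idempotent monad, the unit of `T A` is left adjoint to the multiplication. -/
theorem IsColaxIdempotent.exists_counit (hT : T.IsColaxIdempotent) (A : 𝕂) :
    ∃ θ : VCell (T.mu A ≫ T.iota (T.obj A)) (𝟙 (T.obj (T.obj A))),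
      tot (unitCell (T.iota (T.obj A))) ≫ tot θ = tot (unitCell (T.iota (T.obj A))) ∧
      tot θ ≫ tot (unitCell (T.mu A)) = tot (unitCell (T.mu A)) := by
  -- The cell $\theta$ is the colax structure of $\iota_{TA}$ as a morphism of free algebras; its
  -- target $\mu\circ T\iota$ is an identity. The unit axiom for colax morphisms is one of the
  -- triangle identities.
  obtain ⟨θ, hθ, -⟩ : ∃! θ : VCell (T.mu A ≫ T.iota (T.obj A))
      (T.map (T.iota (T.obj A)) ≫ T.mu (T.obj A)), IsColaxMorphism (T.freeAlgebra A)
        (T.freeAlgebra (T.obj A)) (T.iota (T.obj A)) θ :=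
    hT (T.freeAlgebra A) (T.freeAlgebra (T.obj A)) (T.iota (T.obj A))
  obtain ⟨h₁, h₂⟩ := isColaxMorphism_iff.1 hθ
  have e : T.map (T.iota (T.obj A)) ≫ T.mu (T.obj A) = 𝟙 _ := T.map_iota_mu _
  refine ⟨cst θ rfl e, by rw [tot_cst, h₁], ?_⟩
  rw [tot_cst]
  have b₁ : T.mu A = (T.freeAlgebra A).act ≫ 𝟙 (T.obj A) := (Category.comp_id _).symm
  have b₂ : T.mu A = T.map (𝟙 (T.obj A)) ≫ (T.freeAlgebra A).act := by
    rw [T.map_id, Category.id_comp]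
  have c₁ : (T.mu A ≫ T.iota (T.obj A)) ≫ T.mu A = T.mu A := by
    rw [Category.assoc, T.iota_mu, Category.comp_id]
  have c₂ : (T.map (T.iota (T.obj A)) ≫ T.mu (T.obj A)) ≫ T.mu A = T.mu A := by
    rw [e, Category.id_comp]
  -- For the other triangle identity, both the identity and $\mu\theta$ make $\mathrm{id}_{TA}$ a
  -- colax morphism, the latter because $\mu$ is a strict morphism of algebras; uniqueness then
  -- equates them.
  have hid : IsColaxMorphism (T.freeAlgebra A) (T.freeAlgebra A) (𝟙 (T.obj A))
      (cst (unitCell (T.mu A)) b₁ b₂) := by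
    refine isColaxMorphism_iff.2 ⟨?_, ?_⟩
    · rw [tot_cst, tot_unitCell_of_comp (T.iota_mu A)]
    · have hz : tot (VCell.whiskerRight (T.mapV (cst (unitCell (T.mu A)) b₁ b₂))
          (T.freeAlgebra A).act) = tot (unitCell (T.map (T.mu A) ≫ T.mu A)) := by
        rw [VCell.whiskerRight, tot_vcomp, tot_mapV, tot_cst, ← tot_mapV, mapV_unitCell]
        exact tot_unitCell_of_comp rfl
      rw [tot_ract_of_unitCell _ hz, tot_vc, tot_cst]
      exact (tot_unitCell_of_comp (T.mu_assoc A)).trans (tot_unitCell_of_comp rfl).symm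
  have hcomp : IsColaxMorphism (T.freeAlgebra A) (T.freeAlgebra A) (𝟙 (T.obj A))
      (cst (vc θ (unitCell (T.mu A)) c₁ c₂) b₁ b₂) := by
    refine isColaxMorphism_iff.2 ⟨?_, ?_⟩
    · rw [tot_cst, tot_vc, reassoc_of% h₁, tot_unitCell_of_comp (T.iota_mu _)]
    · rw [tot_cst, tot_vc, reassoc_of% h₂]
      symm
      refine tot_ract_comp_right (by simp) ?_
      rw [VCell.whiskerRight, tot_vcomp, tot_mapV, tot_cst, tot_vc, elTot_comp_unitCell,
        ← Category.assoc, ← tot_mapV, VCell.whiskerRight, tot_vcomp, Category.assoc, Category.assoc]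
      congr 1
      exact (tot_unitCell_of_comp (T.mu_assoc A).symm).trans (tot_unitCell_of_comp rfl).symm
  have := (hT (T.freeAlgebra A) (T.freeAlgebra A) (𝟙 (T.obj A))).unique hcomp hid
  simpa using congrArg tot this

/-! ### The lax algebra axioms and invertibility of the associator -/

namespace RelativeAdjunction

variable {P : 𝕂} {y : A ⟶ P} {w : T.obj P ⟶ P}

/-- The witness is composed with the component of $\mu$ at $J$, so $\mu$ descends a correspondence
from level two to level one. -/
theorem TTRel.comp_mu {S : T.RelativeAdjunction y w} {X Y : 𝕂} {H : Hor X Y}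
    {l : X ⟶ T.obj (T.obj A)} {k : Y ⟶ T.obj (T.obj (T.obj P))}
    {x : (⟨H⟩ : HorObj 𝕂) ⟶ ⟨unit (T.obj (T.obj P))⟩}
    {x' : (⟨H⟩ : HorObj 𝕂) ⟶ ⟨unit (T.obj (T.obj (T.obj P)))⟩} (hr : S.TTRel l k x x')
    {l' : X ⟶ T.obj A} {k' : Y ⟶ T.obj (T.obj P)} (hl : l ≫ T.mu A = l')
    (hk : k ≫ T.mu (T.obj P) = k') :
    S.TRel l' k' (x ≫ tot (unitCell (T.mu P))) (x' ≫ tot (unitCell (T.mu (T.obj P)))) := by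
  obtain ⟨ρ, rfl, rfl⟩ := hr
  refine ⟨vc ρ (T.muCell S.J) hl hk, ?_, ?_⟩
  · rw [tot_vc, Category.assoc, Category.assoc, TTσ, tot_el, Tσ, tot_el, T.comp_mu]
  · rw [tot_vc, Category.assoc, Category.assoc, TTτ, tot_el, Tτ, tot_el, T.comp_mu]

/-- The lax algebra structure. -/
def laxAlgebraStructure (S : T.RelativeAdjunction y w) {what : VCell (𝟙 P) (T.iota P ≫ w)}
    (hwhat : S.IsUnitor what) {wbar : VCell (T.map w ≫ w) (T.mu P ≫ w)}
    (hwbar : S.IsAssociator wbar) : T.LaxAlgebraStructure w where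
  associator := wbar
  unitor := what
  map_unitor_associator := by
    have b : w = T.map (𝟙 P) ≫ w := by rw [T.map_id, Category.id_comp]
    -- Cells out of $w$ are tested on $\sigma$, whose transpose is $\tau$. Along the composite,
    -- $\tau$ is acted on by $T\hat w$, transposed to $T\iota\,\tau$, and returned by the associator
    -- as $\mu\,T\iota\,\tau = \tau$.
    have hη := S.kan (S.cartesian_σ.cst rfl b)
    refine hη.heq_of_ract (η' := S.σ) (by simp) ?_
    rw [ract_unitCell, ract_comp, ract_comp, ract_ofEq]
    have h₁ : S.Rel (𝟙 A) (T.map (T.iota P ≫ w))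
        (tot (ract (cst S.σ rfl b) (VCell.whiskerRight (T.mapV what) w)))
        (tot (ract (cst S.τ rfl (T.map_id P).symm) (T.mapV what))) :=
      AdjRel.ract (k := 𝟙 _) (by simpa using S.rel_σ_τ) rfl
    rw [tot_ract_of_id (T.map_id P), tot_cst] at h₁
    have h₂ := hwhat.tRel S.τ iota_naturality_y (Category.id_comp _)
    have h₃ := hwbar _ _ _ (VCell.whiskerLeft (T.map (T.iota P)) wbar) rfl
      (h₁.congr (T.map_comp _ _) (tot_cst _ rfl (by rw [T.map_comp, Category.assoc])).symm rfl) h₂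
    refine AdjRel.left_unique S.cartesian_τ (h₃.congr (T.map_iota_mu P) rfl ?_) S.rel_σ_τ
    rw [Category.assoc, tot_unitCell_of_comp (T.map_iota_mu P), tot_unitCell_id, Category.comp_id]
  unitor_associator := by
    have hη := S.kan (S.cartesian_σ.cst rfl (Category.comp_id w).symm)
    refine hη.heq_of_ract (η' := S.σ) (by simp) ?_
    rw [ract_unitCell, ract_comp, ract_comp, ract_ofEq]
    have h₀ : tot (ract (cst S.σ rfl (Category.comp_id w).symm) (VCell.whiskerLeft w what)) =
        tot S.σ ≫ tot what := by
      rw [← tot_vc S.σ what (Category.comp_id y) rfl, ← vc_eq_ract S.σ what _ (Category.comp_id w) rfl]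
      exact tot_ract_congr (by simp [tot_unitCell_id]) (by rw [tot_vc]; rfl)
    have h₁ := hwhat.rel S.σ rfl
    rw [← h₀] at h₁
    -- The unitor transposes to $\iota\sigma$, and the component of $\iota$ at $J$ witnesses that
    -- this corresponds to $\iota\tau$ at the next level; the associator then gives $\mu\iota\tau =
    -- \tau$.
    have h₂ : S.TRel (T.iota A) (T.iota (T.obj P)) (tot S.σ ≫ tot (unitCell (T.iota P)))
        (tot S.τ ≫ tot (unitCell (T.iota (T.obj P)))) :=
      ⟨T.iotaCell S.J, by rw [Tσ, tot_el, T.comp_iota], by rw [Tτ, tot_el, T.comp_iota]⟩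
    have h₃ := hwbar _ _ _ (VCell.whiskerLeft (T.iota (T.obj P)) wbar) rfl
      (h₁.congr (T.iota_naturality w) (tot_cst _ rfl (by
        rw [← Category.assoc, T.iota_naturality, Category.assoc])).symm rfl) h₂
    refine AdjRel.left_unique S.cartesian_τ (h₃.congr (T.iota_mu P) rfl ?_) S.rel_σ_τ
    rw [Category.assoc, tot_unitCell_of_comp (T.iota_mu P), tot_unitCell_id, Category.comp_id]
  associator_associator := by
    -- Transposing the universal cell three times gives $\kappa_3$. The two sides of the axiom
    -- become the transposes of $\mu\,T\mu\,\kappa_3$ and $\mu\,\mu_T\,\kappa_3$, equal by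
    -- associativity of $\mu$.
    obtain ⟨K, κ, hκ⟩ := S.isEquipment y (unit P) (T.map (T.map w) ≫ T.map w ≫ w)
    obtain ⟨κ₁, κ₂, h₁, h₂⟩ := S.exists_chain κ rfl
    obtain ⟨κ₃, h₃⟩ := AdjRel.exists_right (l := T.iota A ≫ T.map (T.iota A)) (k := 𝟙 _)
      S.cartesian_TTσ κ₂ (by
        rw [Category.assoc, ← T.map_comp, iota_naturality_y (y := y), iota_map_y_iota]) (Category.id_comp _)
      rfl
    have b : T.map (T.map w) ≫ T.map w = T.map (T.map w ≫ w) := (T.map_comp _ _).symm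
    have b' : T.map (T.map w) ≫ T.map w ≫ w = T.map (T.map w ≫ w) ≫ w := by
      rw [← b, Category.assoc]
    refine (S.kan (hκ.cst rfl b')).heq_of_ract (η' := κ) (by simp) ?_
    rw [ract_comp, ract_comp, ract_ofEq, ract_comp, ract_comp, ract_ofEq]
    have l₁ : S.Rel (𝟙 A) (T.map (T.mu P ≫ w))
        (tot (ract (cst κ rfl b') (VCell.whiskerRight (T.mapV wbar) w)))
        (tot (ract (cst κ₁ rfl b) (T.mapV wbar))) :=
      AdjRel.ract (k := T.map (T.map w) ≫ T.map w) (by simpa using h₁) rfl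
    have l₂ := hwbar.tRel (k := 𝟙 _) (cst κ₁ rfl b) iota_naturality_y (α := T.mapV wbar)
      (by rw [tot_unitCell_id, Category.id_comp]) (by simpa using h₂) h₃
    rw [Category.id_comp] at l₂
    have l₃ := hwbar _ _ _ (VCell.whiskerLeft (T.map (T.mu P)) wbar) rfl
      (l₁.congr (T.map_comp _ _) (tot_cst _ rfl (by rw [T.map_comp, Category.assoc])).symm rfl) l₂
    have r₁ := hwbar κ _ _ (VCell.whiskerLeft (T.map (T.map w)) wbar) rfl h₁ h₂
    have r₂ := TTRel.comp_mu h₃ (l' := T.iota A)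
      (by rw [Category.assoc, T.map_iota_mu, Category.comp_id]) (Category.id_comp _)
    have r₃ := hwbar _ _ _ (VCell.whiskerLeft (T.mu (T.obj P)) wbar) rfl
      (r₁.congr (T.mu_naturality w) (tot_cst _ rfl (by
        rw [← Category.assoc, T.mu_naturality, Category.assoc])).symm rfl) r₂
    refine AdjRel.left_unique S.cartesian_τ (l₃.congr (T.mu_assoc P).symm rfl ?_) r₃
    refine (Category.assoc _ _ _).trans ((congrArg (tot κ₃ ≫ ·) ?_).trans (Category.assoc _ _ _).symm)
    exact (tot_unitCell_of_comp (T.mu_assoc P).symm).trans (tot_unitCell_of_comp rfl).symm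

/-- The associator is invertible. -/
theorem IsAssociator.isInvertible {S : T.RelativeAdjunction y w} (hT : T.IsColaxIdempotent)
    {wbar : VCell (T.map w ≫ w) (T.mu P ≫ w)} (hwbar : S.IsAssociator wbar) :
    wbar.IsInvertible := by
  obtain ⟨θ, hιθ, hθμ⟩ := hT.exists_counit P
  have rel {H : Hor A (T.obj (T.obj P))} (e : Cell y (T.map w ≫ w) H (unit P))
      (x₁ x₂) (h₁ : S.Rel (𝟙 A) (T.map w) (tot e) x₁) (h₂ : S.TRel (T.iota A) (𝟙 _) x₁ x₂) :
      S.Rel (𝟙 A) (T.mu P) (tot (ract e wbar)) (x₂ ≫ tot (unitCell (T.mu P))) := by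
    have := hwbar e x₁ x₂ wbar (by rw [tot_unitCell_id, Category.id_comp])
      (by rwa [Category.id_comp]) h₂
    rwa [Category.id_comp] at this
  -- By naturality of $\iota$ the left boundary of doubly transposed cells factors through
  -- $\iota_{TP}$, along which $\theta$ is an identity; this is what makes the adjunction
  -- applicable.
  have hy : (y ≫ T.iota P) ≫ T.iota (T.obj P) = y ≫ T.iota P ≫ T.map (T.iota P) := by
    rw [Category.assoc, T.iota_naturality]
  refine S.yoneda.isInvertible S.isEquipment wbar (fun H e' => ?_) (fun H e e' h => ?_)
  · obtain ⟨e'₁, h'⟩ := AdjRel.exists_right (τ := S.τ) S.cartesian_σ e' (Category.id_comp y) rfl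
      (Category.id_comp (y ≫ T.iota P))
    -- Surjectivity: the preimage of $x \colon \iota y \Rightarrow \mu$ under $x_2 \mapsto \mu x_2$
    -- is its mate $\theta\cdot\iota x$, which is then transposed back twice.
    let e₂ := ract (vc e'₁ (unitCell (T.iota (T.obj P))) hy rfl) θ
    have he₂ : tot e₂ ≫ tot (unitCell (T.mu P)) = tot e'₁ := by
      have b : (T.mu P ≫ T.iota (T.obj P)) ≫ T.mu P = T.mu P := by
        rw [Category.assoc, T.iota_mu, Category.comp_id]
      have b' : 𝟙 _ ≫ T.mu P = T.mu P := Category.id_comp _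
      rw [← tot_vc e₂ _ rfl b', ← ract_vc _ _ θ rfl b b b', tot_ract_of_unitCell (g := T.mu P),
        tot_vc, tot_vc, Category.assoc, tot_unitCell_of_comp (T.iota_mu P), tot_unitCell_id,
        Category.comp_id]
      rw [tot_vc, hθμ]
    obtain ⟨e₁, h₂⟩ := AdjRel.exists_left S.cartesian_Tτ e₂ iota_naturality_y
      (Category.id_comp (T.map w)) iota_map_y_iota
    obtain ⟨e, h₁⟩ := AdjRel.exists_left S.cartesian_τ e₁ (Category.id_comp y) rfl
      (Category.id_comp (y ≫ T.iota P))
    have h₃ := rel e _ _ h₁ h₂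
    rw [he₂] at h₃
    exact ⟨e, tot_injective (AdjRel.left_unique S.cartesian_τ h₃ h')⟩
  -- Injectivity: $e_2$ is recovered from $\mu e_2$ as $\theta\cdot\iota\mu e_2$, by naturality of
  -- $\theta$ and $\theta\iota = \mathrm{id}$.
  · have aux (e₂ : Cell (y ≫ T.iota P ≫ T.map (T.iota P)) (𝟙 _) H (unit (T.obj (T.obj P)))) :
        tot e₂ = tot (ract (vc (vc e₂ (unitCell (T.mu P)) rfl (Category.id_comp _))
          (unitCell (T.iota (T.obj P))) rfl rfl) θ) := by
      have h₁ : tot (unitCell (y ≫ T.iota P ≫ T.map (T.iota P))) ≫ tot θ =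
          tot (unitCell (y ≫ T.iota P ≫ T.map (T.iota P))) := by
        rw [← hy, tot_unitCell_comp, Category.assoc, hιθ]
      have h₂ := comp_vcell_eq e₂ h₁
      rw [tot_unitCell_id, Category.comp_id] at h₂
      rw [← h₂, ← tot_vc e₂ θ rfl (Category.id_comp _), ← vc_eq_ract e₂ θ rfl (Category.id_comp _)
        (Category.id_comp _)]
      refine tot_ract_congr ?_ ?_
      · rw [tot_vc, tot_vc, tot_vc, Category.assoc, tot_unitCell_of_comp rfl]
      · rw [tot_vc, tot_unitCell_id, Category.id_comp]
    obtain ⟨e₁, e₂, h₁, h₂⟩ := S.exists_chain e (Category.id_comp (T.map w ≫ w))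
    obtain ⟨e'₁, e'₂, h'₁, h'₂⟩ := S.exists_chain e' (Category.id_comp (T.map w ≫ w))
    replace h₁ := h₁.congr (Category.id_comp _) rfl rfl
    replace h'₁ := h'₁.congr (Category.id_comp _) rfl rfl
    have h₃ := rel e _ _ h₁ h₂
    have h'₃ := rel e' _ _ h'₁ h'₂
    rw [h] at h₃
    have h₄ : vc e₂ (unitCell (T.mu P)) rfl (Category.id_comp _) =
        vc e'₂ (unitCell (T.mu P)) rfl (Category.id_comp _) := by
      apply tot_injective
      rw [tot_vc, tot_vc]
      exact AdjRel.right_unique S.cartesian_σ h₃ h'₃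
    have h₅ : tot e₂ = tot e'₂ := by rw [aux e₂, aux e'₂, h₄]
    rw [h₅] at h₂
    rw [AdjRel.left_unique S.cartesian_Tτ h₂ h'₂] at h₁
    exact tot_injective (AdjRel.left_unique S.cartesian_τ h₁ h'₁)

end RelativeAdjunction

end NormalLaxDoubleMonad

/-! ### Invertibility of the unitor and full faithfulness of the unit -/

namespace NormalLaxDoubleMonad

variable {𝕂 : Type u} [DoubleCategory.{c, h, v} 𝕂] {T : NormalLaxDoubleMonad 𝕂} {A P : 𝕂}

/-- For a colax-idempotent monad, an inverse `v` of a cell `id ⇒ w ∘ ι` gives rise to a counit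
`ι ∘ w ⇒ id`. -/
theorem IsColaxIdempotent.exists_counit_of_cell (hT : T.IsColaxIdempotent) {w : T.obj P ⟶ P}
    (v : VCell (T.iota P ≫ w) (𝟙 P)) :
    ∃ ε : VCell (w ≫ T.iota P) (𝟙 (T.obj P)),
      tot (unitCell (T.iota P)) ≫ tot ε = tot v ≫ tot (unitCell (T.iota P)) := by
  obtain ⟨θ, hιθ, -⟩ := hT.exists_counit P
  have b₁ : T.map (T.iota P) ≫ T.mu P ≫ T.iota (T.obj P) = T.iota (T.obj P) := by
    rw [← Category.assoc, T.map_iota_mu, Category.id_comp]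
  -- This is $\theta$ restricted along $T\iota$, a cell $\iota_{TP} \Rightarrow T\iota$ since
  -- $\mu\circ T\iota = \mathrm{id}$; it becomes an identity along $\iota_P$. The counit is then
  -- $\iota w = Tw\,\iota_{TP} \Rightarrow Tw\,T\iota = T(w\iota) \Rightarrow \mathrm{id}$, ending
  -- with $Tv$.
  let lam : VCell (T.iota (T.obj P)) (T.map (T.iota P)) :=
    vc (unitCell (T.map (T.iota P))) θ b₁ (Category.comp_id _)
  have hlam : tot (unitCell (T.iota P)) ≫ tot lam =
      tot (unitCell (T.iota P ≫ T.iota (T.obj P))) := by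
    rw [tot_vc, ← Category.assoc, tot_unitCell_of_comp (T.iota_naturality (T.iota P)).symm,
      tot_unitCell_comp, Category.assoc, hιθ]
  let ε := ract (vc lam (unitCell (T.map w)) (T.iota_naturality w).symm (T.map_comp _ _).symm)
    (T.mapV v)
  refine ⟨cst ε rfl (T.map_id P), ?_⟩
  have h₁ : tot (unitCell (T.iota P)) ≫ tot (vc lam (unitCell (T.map w))
      (T.iota_naturality w).symm (T.map_comp _ _).symm) =
        tot (unitCell ((T.iota P ≫ T.iota (T.obj P)) ≫ T.map w)) := by
    rw [tot_vc, reassoc_of% hlam, tot_unitCell_of_comp rfl]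
  rw [tot_cst, ← tot_ract_of_comp (tot_vc (unitCell (T.iota P)) _ rfl rfl)
    (tot_vc (unitCell (T.iota P)) (T.mapV v) rfl rfl), tot_ract_unitCell_left (by rw [tot_vc, h₁]),
    tot_vc, iota_mapV]

/-- If `id ⇒ w ∘ ι` is invertible then `ι` is full and faithful. -/
theorem IsColaxIdempotent.fullFaithful (hT : T.IsColaxIdempotent) {w : T.obj P ⟶ P}
    {what : VCell (𝟙 P) (T.iota P ≫ w)} (hw : what.IsInvertible) : FullFaithful (T.iota P) := by
  -- Only the half $v\circ\hat w = \mathrm{id}$ of invertibility is needed.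
  obtain ⟨v, hv, -⟩ := hw
  obtain ⟨ε, hε⟩ := hT.exists_counit_of_cell v
  rw [VCell.comp_eq_ract] at hv
  refine IsCartesian.mk (fun X Y l k H χ => ?_) (fun X Y l k H φ φ' e => ?_)
  -- A cell $\chi \colon \iota l \Rightarrow \iota k$ is lifted to $l \Rightarrow w\iota l
  -- \Rightarrow w\iota k \Rightarrow k$, using $\hat w$, $w\chi$ and $v$. After applying $\iota$,
  -- the last step becomes $\varepsilon\iota$; sliding $\varepsilon$ past $\chi$ brings it next to
  -- $\hat w$, where the two cancel.
  · let r := ract (vc χ (unitCell w) (Category.assoc _ _ _) (Category.assoc _ _ _))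
      (vc (unitCell k) v rfl (Category.comp_id k))
    let α : VCell l (l ≫ T.iota P ≫ w) := vc (unitCell l) what (Category.comp_id l) rfl
    refine ⟨lact α r, ?_⟩
    have bl : (l ≫ T.iota P ≫ w) ≫ T.iota P = (l ≫ T.iota P) ≫ w ≫ T.iota P := by
      simp only [Category.assoc]
    have bk : (k ≫ T.iota P ≫ w) ≫ T.iota P = (k ≫ T.iota P) ≫ w ≫ T.iota P := by
      simp only [Category.assoc]
    have bk' : k ≫ T.iota P = (k ≫ T.iota P) ≫ 𝟙 _ := (Category.comp_id _).symm
    have h₁ : ∀ {Z : 𝕂} (m : Z ⟶ P), tot (unitCell m) ≫ tot v ≫ tot (unitCell (T.iota P)) =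
        tot (unitCell (m ≫ T.iota P)) ≫ tot ε := by
      intro Z m
      rw [← hε, ← Category.assoc, tot_unitCell_of_comp rfl]
    have h₂ : vc r (unitCell (T.iota P)) bl rfl = vc χ ε rfl bk'.symm := by
      apply tot_injective
      rw [← vc_eq_ract χ ε rfl rfl bk'.symm, ← ract_vc _ _ _ bl bk bk rfl]
      refine tot_ract_congr ?_ ?_
      · rw [tot_vc, tot_vc, tot_vc, Category.assoc, tot_unitCell_of_comp rfl]
      · rw [tot_vc, tot_vc, tot_vc, Category.assoc, h₁]
    rw [← tot_vc _ _ rfl rfl, ← lact_vc r _ α rfl rfl bl bl, h₂,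
      ← vc_eq_lact χ ε rfl bk'.symm (Category.comp_id _), ← lact_comp, tot_lact_of_unitCell
      (g := l ≫ T.iota P), tot_vc, tot_unitCell_id, Category.comp_id]
    have b : l ≫ (T.iota P ≫ w) ≫ T.iota P = (l ≫ T.iota P) ≫ w ≫ T.iota P := by
      simp only [Category.assoc]
    rw [VCell.comp_eq_ract, tot_ract_comp_right (e := α) (σ := unitCell (T.iota P))
      (α := vc (unitCell l) v rfl (Category.comp_id l)) (tot_vc _ _ _ _)
      (by rw [tot_vc, tot_vc, Category.assoc, h₁]), tot_ract_of_comp (tot_vc _ _ _ _) (tot_vc _ _ _ _),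
      hv, tot_unitCell_id, Category.comp_id, tot_unitCell_of_comp rfl]
  -- By naturality of $\hat w$ the same formula recovers $\phi$ from $\iota\phi$, which gives
  -- uniqueness.
  · have key (φ : Cell l k H (unit P)) : tot φ = tot (ract (lact
        (vc (unitCell l) what (Category.comp_id l) rfl)
        (vc (vc φ (unitCell (T.iota P)) rfl rfl) (unitCell w) (Category.assoc _ _ _)
          (Category.assoc _ _ _))) (vc (unitCell k) v rfl (Category.comp_id k))) := by
      have h₁ : vc (vc φ (unitCell (T.iota P)) rfl rfl) (unitCell w) (Category.assoc _ _ _)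
          (Category.assoc _ _ _) = vc φ (unitCell (T.iota P ≫ w)) rfl rfl := by
        apply tot_injective
        rw [tot_vc, tot_vc, tot_vc, Category.assoc, tot_unitCell_of_comp rfl]
      rw [h₁, vc_eq_lact φ what (Category.comp_id l) rfl rfl,
        vc_ract φ what v (Category.comp_id l) rfl rfl (Category.comp_id k), hv, tot_vc,
        tot_unitCell_id, Category.comp_id]
    have e' : vc φ (unitCell (T.iota P)) rfl rfl = vc φ' (unitCell (T.iota P)) rfl rfl :=
      tot_injective (by rw [tot_vc, tot_vc, e])
    rw [key φ, key φ', e']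

/-- Acting with the unitor on cells $y \Rightarrow \mathrm{id}$ is, up to transposition, composing
with $\iota$. Full faithfulness makes the latter bijective, and the Yoneda argument concludes. -/
theorem RelativeAdjunction.IsUnitor.isInvertible {y : A ⟶ P} {w : T.obj P ⟶ P}
    {S : T.RelativeAdjunction y w} {what : VCell (𝟙 P) (T.iota P ≫ w)} (hw : S.IsUnitor what)
    (hι : FullFaithful (T.iota P)) : what.IsInvertible := by
  have rel {H : Hor A P} (e : Cell y (𝟙 P) H (unit P)) :
      S.Rel (𝟙 A) (T.iota P) (tot (ract e what)) (tot e ≫ tot (unitCell (T.iota P))) := by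
    rw [tot_ract_of_id rfl]
    exact hw.rel e (Category.id_comp _)
  refine S.yoneda.isInvertible S.isEquipment what (fun H e' => ?_) (fun H e e' h => ?_)
  · obtain ⟨e₁, h₁⟩ := AdjRel.exists_right (τ := S.τ) S.cartesian_σ e' (Category.id_comp y) rfl
      (Category.id_comp (y ≫ T.iota P))
    obtain ⟨e, he⟩ := IsCartesian.exists_vc hι e₁ rfl (Category.id_comp _)
    have h₂ := rel e
    rw [he] at h₂
    exact ⟨e, tot_injective (AdjRel.left_unique S.cartesian_τ h₂ h₁)⟩
  · have h₁ := rel e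
    rw [h] at h₁
    exact IsCartesian.cancel hι (AdjRel.right_unique S.cartesian_σ h₁ (rel e'))

end NormalLaxDoubleMonad

theorem mainTheorem4 {𝕂 : Type u} [DoubleCategory.{c, h, v} 𝕂] (hK : IsEquipment 𝕂)
    (T : NormalLaxDoubleMonad 𝕂) (hT : T.IsColaxIdempotent)
    {A P : 𝕂} (y : A ⟶ P) (hy : IsYonedaEmbedding y)
    (yStar : Hor A P) (yCart : Cell y (𝟙 P) yStar (unit P)) (hyCart : IsCompanion y yStar yCart)
    (iStar : Hor P (T.obj P)) (iCart : Cell (T.iota P) (𝟙 (T.obj P)) iStar (unit (T.obj P)))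
    (hiCart : IsCompanion (T.iota P) iStar iCart)
    (w : T.obj P ⟶ P) (wCart : Cell y w (hor yStar iStar) (unit P))
    (hwCart : IsCartesian wCart) :
    ∃ W : T.LaxAlgebraStructure w,
      VCell.IsInvertible W.associator ∧
      (VCell.IsInvertible W.unitor ↔ FullFaithful (T.iota P)) := by
  -- The composite $y_*\odot\iota_* \to \iota_* \to 1$ of two cartesian cells makes
  -- $y_*\odot\iota_*$ a companion of $\iota y$.
  let τ : Cell (y ≫ T.iota P) (𝟙 (T.obj P)) (hor yStar iStar) (unit (T.obj P)) :=
    vc (vc (hcomp yCart (vid iStar)) (leftUnitor iStar) (Category.comp_id y) (Category.comp_id _))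
      iCart rfl (Category.comp_id _)
  have hτ : IsCartesian τ := (isCartesian_companion_hor hyCart iStar).of_tot_comp hiCart rfl
    (Category.comp_id _) (tot_vc _ _ _ _)
  let S : T.RelativeAdjunction y w :=
    { isEquipment := hK
      yoneda := hy
      J := hor yStar iStar
      σ := wCart
      τ := τ
      cartesian_σ := hwCart
      cartesian_τ := hτ
      Y := yStar
      ε := yCart
      cartesian_ε := hyCart }
  obtain ⟨what, hwhat⟩ := S.exists_isUnitor
  obtain ⟨wbar, hwbar⟩ := S.exists_isAssociator
  exact ⟨S.laxAlgebraStructure hwhat hwbar, hwbar.isInvertible hT,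
    hT.fullFaithful, hwhat.isInvertible⟩
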